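/- Fix countably infinite sets of variables and of nulls, and a set of predicates $p$, each with an arity $\mathrm{ar}(p)\ge 0$, that contains countably infinitely many predicates of every arity. Let $\mathsf{Goal}$ be a predicate of arity $0$. A *disjunctive existential rule* is a formula $\rho=\forall \vec x.\,\bigl(\beta[\vec x]\to\bigvee_{i=1}^{k}\exists \vec y_i.\,\eta_i[\vec x_i,\vec y_i]\bigr)$ with $k\ge 1$, $\vec x_i\subseteq\vec x$, and $\vec x,\vec y_1,\dots,\vec y_k$ mutually disjoint, where $\beta$ is a possibly empty conjunction, and each $\eta_i$ a non-empty conjunction, of atoms $p(z_1,\dots,z_{\mathrm{ar}(p)})$ over exactly the indicated variables. It is an *existential rule* if $k=1$, and a *disjunctive Datalog rule* if all $\vec y_i$ are empty. An *interpretation* is a set of facts $p(\vec n)$ with $\vec n$ a list of nulls of length $\mathrm{ar}(p)$; a *database* is a finite interpretation; it is *over* a set of predicates if it uses no others. A *homomorphism* $\mathcal I\to\mathcal J$ is a map on nulls that sends the facts of $\mathcal I$ to facts of $\mathcal J$. Given $\rho$, an interpretation $\mathcal I$ and $\sigma:\vec x\to\text{nulls}$ with $\sigma(\beta)\subseteq\mathcal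 I$, the pair $\langle\rho,\sigma\rangle$ is *applicable* to $\mathcal I$ if there are no $i$ and no extension $\sigma'$ of $\sigma$ to $\vec y_i$ with $\sigma'(\eta_i)\subseteq\mathcal I$; $\mathcal I$ *satisfies* $\rho$ if no $\langle\rho,\sigma\rangle$ is applicable to $\mathcal I$. For a rule set $\Sigma$ and a database $\mathcal D$, write $\mathcal D,\Sigma\models\mathsf{Goal}$ if $\mathsf{Goal}\in\mathcal I$ for every interpretation $\mathcal I$ that satisfies all rules of $\Sigma$ and admits a homomorphism $\mathcal D\to\mathcal I$. A *chase tree* for $\langle\Sigma,\mathcal D\rangle$ is a finite or infinite tree whose nodes are labelled by interpretations such that: (a) the root is labelled $\mathcal D$; (b) for every node with at least one child, with label $\mathcal E$, there are $\rho\in\Sigma$ as above and $\sigma$ such that $\langle\rho,\sigma\rangle$ is applicable to $\mathcal E$ and the node has exactly $k$ children, the $i$-th labelled $\mathcal E\cup\sigma_i(\eta_i)$, where $\sigma_i$ extends $\sigma$ by mapping the variables of $\vec y_i$ to pairwise distinct nulls that do not occur in $\mathcal E$; (c) (fairness) for every branch, that is, every maximal path from the root, every $\rho\in\Sigma$ and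 every $\sigma$, there is a node on the branch such that $\langle\rho,\sigma\rangle$ is not applicable to the label of this node nor of any later node of the branch. The *result* of a chase tree is the set of the unions of all labels along a branch, over all branches; a *chase result* over $\langle\Sigma,\mathcal D\rangle$ is the result of some chase tree. If all rules of $\Sigma$ are existential, a chase result is a one-element set. $\langle\Sigma,\mathcal D\rangle$ is *chase-terminating* if all its chase trees are finite. For a rule set $\Sigma$, let $\mathrm{H}(\Sigma)$ be the set of predicates that occur in a rule head of $\Sigma$, and let $\mathcal S_{\mathsf{in}}(\Sigma)$ be the set of predicates that occur in $\Sigma$ but not in $\mathrm{H}(\Sigma)$. A *split* of $\Sigma$ consists of a set $\Sigma_1$ of disjunctive Datalog rules and a set $\Sigma_2$ of existential rules such that $\Sigma=\Sigma_1\cup\Sigma_2$ and, for every database $\mathcal D$ over $\mathcal S_{\mathsf{in}}(\Sigma)$ and every chase result $\mathfrak M$ over $\langle\Sigma,\mathcal D\rangle$, there are a chase result $\mathfrak M_1$ over $\langle\Sigma_1,\mathcal D\rangle$ and interpretations $\mathcal C_{\mathcal I}$, for $\mathcal I\in\mathfrak M_1$, such that each $\{\mathcal C_{\mathcal I}\}$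 is a chase result over $\langle\Sigma_2,\mathcal I\rangle$ and $\mathfrak M=\{\mathcal C_{\mathcal I}\mid\mathcal I\in\mathfrak M_1\}$. **Lemma.** Let $\Sigma$ be a finite set of disjunctive existential rules with split $\langle\Sigma_1,\Sigma_2\rangle$. There is a finite set $\Sigma'$ of existential rules such that, for every database $\mathcal D$ over $\mathcal S_{\mathsf{in}}(\Sigma)$: 1. $\mathcal D,\Sigma\models\mathsf{Goal}$ if and only if $\mathcal D,\Sigma'\models\mathsf{Goal}$; and 2. if $\langle\Sigma_2,\mathcal D_2\rangle$ is chase-terminating for every database $\mathcal D_2$ over $\mathcal S_{\mathsf{in}}(\Sigma_2)\cup(\mathrm H(\Sigma_1)\cap\mathrm H(\Sigma_2))$, then $\langle\Sigma',\mathcal D\rangle$ is also chase-terminating. (If $\Sigma_1$ and $\Sigma_2$ share no head predicate, the databases in item 2 are exactly those over $\mathcal S_{\mathsf{in}}(\Sigma_2)$.) -/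

import Mathlib

namespace DisjRules

/-- Predicates: for every arity there are countably many. -/
structure Predicate where
  name : ℕ
  arity : ℕ

/-- The countably infinite set of variables. -/
abbrev Var := ℕ

/-- The countably infinite set of nulls. -/
abbrev Null := ℕ

/-- Expressions `p(t₁, …, tₖ)` with `k` the arity of `p` and terms `tᵢ` in `T`. -/
structure Atom (T : Type) where
  pred : Predicate
  args : Fin pred.arity → T

/-- Apply a map to the terms of an atom (a substitution, or a map between nulls). -/
def Atom.map {T U : Type} (f : T → U) (a : Atom T) : Atom U :=
  ⟨a.pred, fun i => f (a.args i)⟩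

/-- The variables that occur in a conjunction of atoms. -/
def varsOf (c : List (Atom Var)) : Set Var := {x | ∃ a ∈ c, ∃ i, a.args i = x}

/-- A disjunctive existential rule `∀ x. (β[x] → ⋁ᵢ ∃ yᵢ. ηᵢ[xᵢ, yᵢ])`. The universally quantified
variables are those of the body `β`; the variables of a disjunct `ηᵢ` that do not occur in the body
are existentially quantified in that disjunct. Bodies may be empty, heads may not. -/
structure Rule where
  body : List (Atom Var)
  head : List (List (Atom Var))
  head_ne_nil : head ≠ []
  disjunct_ne_nil : ∀ η ∈ head, η ≠ []

/-- Existential rules: the head has exactly one disjunct. -/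
def Rule.IsExistential (ρ : Rule) : Prop := ρ.head.length = 1

/-- Disjunctive Datalog rules: there are no existentially quantified variables. -/
def Rule.IsDisjunctiveDatalog (ρ : Rule) : Prop := ∀ η ∈ ρ.head, varsOf η ⊆ varsOf ρ.body

/-- Interpretations are sets of expressions `p(n₁, …, nₖ)` with `nᵢ` nulls. -/
abbrev Interpretation := Set (Atom Null)

/-- Databases are finite interpretations. -/
def IsDatabase (D : Interpretation) : Prop := D.Finite

/-- `I` only uses predicates of `S`. -/
def IsOver (S : Set Predicate) (I : Interpretation) : Prop := ∀ a ∈ I, a.pred ∈ S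

/-- The nulls that occur in an interpretation. -/
def nullsOf (I : Interpretation) : Set Null := {n | ∃ a ∈ I, ∃ i, a.args i = n}

/-- `h` is a homomorphism from `I` to `J` (only its values on the nulls of `I` matter). -/
def IsHom (h : Null → Null) (I J : Interpretation) : Prop := ∀ a ∈ I, a.map h ∈ J

/-- The conjunction `c` holds in `I` under the substitution `σ`, that is, `σ(c) ⊆ I`. -/
def Holds (σ : Var → Null) (c : List (Atom Var)) (I : Interpretation) : Prop :=
  ∀ a ∈ c, a.map σ ∈ I

/-- For some disjunct `η` of the head of `ρ`, some extension of `σ` (restricted to the variables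
of the body) maps `η` into `I`. -/
def Rule.HeadHolds (ρ : Rule) (σ : Var → Null) (I : Interpretation) : Prop :=
  ∃ η ∈ ρ.head, ∃ σ' : Var → Null, Set.EqOn σ' σ (varsOf ρ.body) ∧ Holds σ' η I

/-- `I` satisfies the rule `ρ`. -/
def Rule.SatisfiedBy (ρ : Rule) (I : Interpretation) : Prop :=
  ∀ σ : Var → Null, Holds σ ρ.body I → ρ.HeadHolds σ I

/-- The pair `⟨ρ, σ⟩` is applicable to `I`. -/
def Rule.Applicable (ρ : Rule) (σ : Var → Null) (I : Interpretation) : Prop :=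
  Holds σ ρ.body I ∧ ¬ ρ.HeadHolds σ I

/-- `I` is a model of the set `S` of rules. -/
def IsModelOfRules (I : Interpretation) (S : Set Rule) : Prop := ∀ ρ ∈ S, ρ.SatisfiedBy I

/-- `I` is a model of the interpretation (or database) `J`: there is a homomorphism `J → I`. -/
def IsModelOf (I J : Interpretation) : Prop := ∃ h : Null → Null, IsHom h J I

/-- `S, D ⊨ C`: every model of the rule set `S` and of the database `D` is a model of `C`. -/
def Entails (S : Set Rule) (D C : Interpretation) : Prop :=
  ∀ I : Interpretation, IsModelOfRules I S → IsModelOf I D → IsModelOf I C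

/-- For a nullary predicate `p`, the database that consists of the fact `p()`. -/
def nullaryFact (p : Predicate) (hp : p.arity = 0) : Interpretation :=
  {⟨p, fun i => Fin.elim0 (hp ▸ i)⟩}

/-- `σ'` extends `σ` (restricted to the variables of the body of `ρ`) by mapping the existentially
quantified variables of the disjunct `η` to pairwise distinct nulls that do not occur in `I`. -/
def Rule.IsFreshExtension (ρ : Rule) (η : List (Atom Var)) (I : Interpretation)
    (σ σ' : Var → Null) : Prop :=
  Set.EqOn σ' σ (varsOf ρ.body) ∧
    Set.InjOn σ' (varsOf η \ varsOf ρ.body) ∧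
      ∀ y ∈ varsOf η \ varsOf ρ.body, σ' y ∉ nullsOf I

/-- A labelled tree. Nodes are represented by their address: `[]` is the root, and the children of
the node `v` are the nodes of the form `i :: v`. -/
structure LabelledTree where
  nodes : Set (List ℕ)
  root_mem : [] ∈ nodes
  parent_mem : ∀ i v, i :: v ∈ nodes → v ∈ nodes
  label : List ℕ → Interpretation

/-- The branches of a tree: the paths that start in the root and are maximal, that is, they are
infinite or end in a leaf. -/
def LabelledTree.IsBranch (T : LabelledTree) (P : Set (List ℕ)) : Prop :=
  [] ∈ P ∧ P ⊆ T.nodes ∧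
    (∀ i v, i :: v ∈ P → v ∈ P) ∧
      (∀ i j v, i :: v ∈ P → j :: v ∈ P → i = j) ∧
        ∀ v ∈ P, (∃ i, i :: v ∈ T.nodes) → ∃ i, i :: v ∈ P

/-- The children of the node `v` of `T` result from applying `⟨ρ, σ⟩` to the label of `v`: there is
one child for every disjunct of the head, labelled with the label of `v` extended by the instance of
this disjunct with fresh nulls for its existentially quantified variables. -/
def LabelledTree.IsRuleApplication (T : LabelledTree) (v : List ℕ) (ρ : Rule) (σ : Var → Null) :
    Prop :=
  ρ.Applicable σ (T.label v) ∧
    (∀ i, i :: v ∈ T.nodes ↔ i < ρ.head.length) ∧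
      ∀ (i : ℕ) (hi : i < ρ.head.length), ∃ σ' : Var → Null,
        ρ.IsFreshExtension ρ.head[i] (T.label v) σ σ' ∧
          T.label (i :: v) = T.label v ∪ {b | ∃ a ∈ ρ.head[i], b = a.map σ'}

/-- `T` is a (standard) chase tree for the rule set `S` and the database `D`. The last conjunct is
fairness: on every branch, every `⟨ρ, σ⟩` is inapplicable from some node on; in particular, nothing
is applicable to the label of a leaf. -/
def IsChaseTree (S : Set Rule) (D : Interpretation) (T : LabelledTree) : Prop :=
  T.label [] = D ∧
    (∀ v ∈ T.nodes, (∃ i, i :: v ∈ T.nodes) →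
      ∃ ρ ∈ S, ∃ σ : Var → Null, T.IsRuleApplication v ρ σ) ∧
      ∀ P, T.IsBranch P → ∀ ρ ∈ S, ∀ σ : Var → Null,
        ∃ v ∈ P, ∀ u ∈ P, v.length ≤ u.length → ¬ ρ.Applicable σ (T.label u)

/-- The result of a chase tree: the set of the unions of all labels along a branch. -/
def LabelledTree.result (T : LabelledTree) : Set Interpretation :=
  {I | ∃ P, T.IsBranch P ∧ I = ⋃ v ∈ P, T.label v}

/-- `M` is a chase result over `⟨S, D⟩`. -/
def IsChaseResult (S : Set Rule) (D : Interpretation) (M : Set Interpretation) : Prop :=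
  ∃ T : LabelledTree, IsChaseTree S D T ∧ M = T.result

/-- `⟨S, D⟩` is chase-terminating: all its chase trees are finite. -/
def ChaseTerminating (S : Set Rule) (D : Interpretation) : Prop :=
  ∀ T : LabelledTree, IsChaseTree S D T → T.nodes.Finite

/-- The predicates that occur in a rule head of `S`. -/
def headPredicates (S : Set Rule) : Set Predicate :=
  {p | ∃ ρ ∈ S, ∃ η ∈ ρ.head, ∃ a ∈ η, a.pred = p}

/-- The predicates that occur in a rule body of `S`. -/
def bodyPredicates (S : Set Rule) : Set Predicate :=
  {p | ∃ ρ ∈ S, ∃ a ∈ ρ.body, a.pred = p}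

/-- The input schema of `S`: the predicates in `S` that do not occur in any rule head. -/
def inputSchema (S : Set Rule) : Set Predicate :=
  (bodyPredicates S ∪ headPredicates S) \ headPredicates S

/-- `⟨S₁, S₂⟩` is a split of `S`. -/
def IsSplit (S S₁ S₂ : Set Rule) : Prop :=
  (∀ ρ ∈ S₁, ρ.IsDisjunctiveDatalog) ∧ (∀ ρ ∈ S₂, ρ.IsExistential) ∧ S = S₁ ∪ S₂ ∧
    ∀ D : Interpretation, IsDatabase D → IsOver (inputSchema S) D →
      ∀ M : Set Interpretation, IsChaseResult S D M →
        ∃ M₁ : Set Interpretation, IsChaseResult S₁ D M₁ ∧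
          ∃ C : Interpretation → Interpretation,
            (∀ I ∈ M₁, IsChaseResult S₂ I {C I}) ∧ M = C '' M₁

end DisjRules

open DisjRules

/-! The chase with `S₁` branches, and existential rules imitate it by turning its nodes into nulls,
called worlds. A world stands for the list of disjunct instances (a rule, a disjunct, values of the
body variables) chosen since a root world. Facts carry the world they belong to, except facts over
the input schema, which no rule derives. If a body of `S₁` matches in a complete world, `branchRule`
provides a successor world for each disjunct. `inheritRule` collects in a world the disjuncts chosen
by its ancestors, and `doneRule` declares the world complete once the root is reached. Rules of `S₂`
run only inside complete worlds. A world is accepted if it contains the goal or if, for some body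
match, the successors for all disjuncts are accepted; the goal follows if the root is accepted.

Worlds have two layers. Branching only looks at layer 0, which holds the chosen disjuncts; layer 1
holds these as well, and `S₂` works there. Hence consequences of `S₂` never trigger `S₁`, which is
the separation that a split allows, and layer 0 mentions only nulls of the database.

No false consequences (`entails_of_entails_worldRules`): a model of the given rules without the goal
expands to a model with two worlds, a good one that copies the given model and a bad, accepted one
in which all heads hold. Instances that hold lead to the good world, all others to the bad one; the
good world is never accepted.

No lost consequences (`entails_worldRules`): in a model of the new rules without the goal,
unaccepted worlds lead down the chase tree of `S₁` to a leaf. By the split, the chase of `S₂` from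
this leaf yields the goal; layer 1 of the world is a model of `S₂` that receives the leaf, so it
contains the goal and the world is accepted, a contradiction.

Termination (`worldRules_chaseTerminating`): a world that already contains an instance is its own
successor for it, so lists have no repetitions, and distinct worlds have distinct lists. Hence there
are finitely many worlds and finitely many steps outside the simulation of `S₂`. In each world, the
simulation is a fair chase with `S₂` from a finite database over the permitted predicates. -/

namespace DisjRules

/-! ### Atoms, conjunctions, finiteness and numberings -/

/-- The list of arguments of an atom. -/
def Atom.toList {T : Type} (a : Atom T) : List T := List.ofFn a.args

theorem Atom.ext_list {T : Type} {a b : Atom T} (hn : a.pred.name = b.pred.name)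
    (hl : a.toList = b.toList) : a = b := by
  obtain ⟨⟨n, k⟩, f⟩ := a
  obtain ⟨⟨m, l⟩, g⟩ := b
  have hk : k = l := by simpa [Atom.toList] using congrArg List.length hl
  subst hk
  simp only at hn
  subst hn
  have : f = g := List.ofFn_injective hl
  rw [this]

theorem Atom.length_toList {T : Type} (a : Atom T) : a.toList.length = a.pred.arity := by
  simp [Atom.toList]

@[simp] theorem Atom.toList_map {T U : Type} (f : T → U) (a : Atom T) :
    (a.map f).toList = a.toList.map f := by
  simp [Atom.toList, Atom.map, List.map_ofFn, Function.comp_def]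

@[simp] theorem Atom.pred_map {T U : Type} (f : T → U) (a : Atom T) : (a.map f).pred = a.pred := rfl

theorem Atom.map_map {T U V : Type} (f : T → U) (g : U → V) (a : Atom T) :
    (a.map f).map g = a.map (fun x => g (f x)) := rfl

theorem Atom.mem_toList {T : Type} {a : Atom T} {t : T} : t ∈ a.toList ↔ ∃ i, a.args i = t := by
  simp [Atom.toList, List.mem_ofFn]

/-- The atom with the given predicate name and list of arguments. -/
def mkAtom {T : Type} (n : ℕ) (l : List T) : Atom T := ⟨⟨n, l.length⟩, l.get⟩

@[simp] theorem mkAtom_toList {T : Type} (n : ℕ) (l : List T) : (mkAtom n l).toList = l := by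
  simp [mkAtom, Atom.toList]

@[simp] theorem mkAtom_name {T : Type} (n : ℕ) (l : List T) : (mkAtom n l).pred.name = n := rfl

theorem mkAtom_inj {T : Type} {n m : ℕ} {l k : List T} :
    mkAtom n l = mkAtom m k ↔ n = m ∧ l = k := by
  constructor
  · intro h
    exact ⟨congrArg (fun a => a.pred.name) h, by
      simpa using congrArg Atom.toList h⟩
  · rintro ⟨rfl, rfl⟩; rfl

theorem mkAtom_map {T U : Type} (f : T → U) (n : ℕ) (l : List T) :
    (mkAtom n l).map f = mkAtom n (l.map f) :=
  Atom.ext_list rfl (by simp)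

theorem Atom.map_congr {T U : Type} {f g : T → U} {a : Atom T}
    (h : ∀ t ∈ a.toList, f t = g t) : a.map f = a.map g :=
  Atom.ext_list rfl (by simpa using h)

theorem mem_varsOf {c : List (Atom Var)} {x : Var} : x ∈ varsOf c ↔ ∃ a ∈ c, x ∈ a.toList := by
  simp [varsOf, Atom.mem_toList]

theorem mem_nullsOf {I : Interpretation} {n : Null} : n ∈ nullsOf I ↔ ∃ a ∈ I, n ∈ a.toList := by
  simp [nullsOf, Atom.mem_toList]

@[simp] theorem varsOf_nil : varsOf [] = ∅ := by
  ext x; simp [mem_varsOf]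

@[simp] theorem mem_varsOf_cons {a : Atom Var} {c : List (Atom Var)} {x : Var} :
    x ∈ varsOf (a :: c) ↔ x ∈ a.toList ∨ x ∈ varsOf c := by
  simp [mem_varsOf]

@[simp] theorem mem_varsOf_append {b c : List (Atom Var)} {x : Var} :
    x ∈ varsOf (b ++ c) ↔ x ∈ varsOf b ∨ x ∈ varsOf c := by
  simp [mem_varsOf, or_and_right, exists_or]

@[simp] theorem holds_nil {σ : Var → Null} {I : Interpretation} : Holds σ [] I := by
  simp [Holds]

@[simp] theorem holds_cons {σ : Var → Null} {a : Atom Var} {c : List (Atom Var)}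
    {I : Interpretation} : Holds σ (a :: c) I ↔ a.map σ ∈ I ∧ Holds σ c I := by
  simp [Holds]

@[simp] theorem holds_append {σ : Var → Null} {b c : List (Atom Var)}
    {I : Interpretation} : Holds σ (b ++ c) I ↔ Holds σ b I ∧ Holds σ c I := by
  simp [Holds, or_imp, forall_and]

theorem Holds.mono {σ : Var → Null} {c : List (Atom Var)} {I J : Interpretation}
    (h : Holds σ c I) (hIJ : I ⊆ J) : Holds σ c J := fun a ha => hIJ (h a ha)

theorem map_eqOn {σ τ : Var → Null} {c : List (Atom Var)}
    (h : Set.EqOn σ τ (varsOf c)) {a : Atom Var} (ha : a ∈ c) : a.map σ = a.map τ :=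
  Atom.map_congr fun _ ht => h (mem_varsOf.2 ⟨a, ha, ht⟩)

theorem Holds.congr {σ τ : Var → Null} {c : List (Atom Var)} {I : Interpretation}
    (h : Holds σ c I) (he : Set.EqOn τ σ (varsOf c)) : Holds τ c I := fun a ha => by
  rw [map_eqOn he ha]; exact h a ha

theorem Rule.HeadHolds.mono {ρ : Rule} {σ : Var → Null} {I J : Interpretation}
    (h : ρ.HeadHolds σ I) (hIJ : I ⊆ J) : ρ.HeadHolds σ J := by
  obtain ⟨η, hη, σ', he, hh⟩ := h
  exact ⟨η, hη, σ', he, hh.mono hIJ⟩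

theorem Rule.HeadHolds.congr {ρ : Rule} {σ τ : Var → Null} {I : Interpretation}
    (h : ρ.HeadHolds σ I) (he : Set.EqOn σ τ (varsOf ρ.body)) : ρ.HeadHolds τ I := by
  obtain ⟨η, hη, σ', he', hh⟩ := h
  exact ⟨η, hη, σ', he'.trans he, hh⟩

theorem nullsOf_finite {I : Interpretation} (h : I.Finite) : (nullsOf I).Finite := by
  have : nullsOf I = ⋃ a ∈ I, {n | n ∈ a.toList} := by
    ext n; simp [mem_nullsOf]
  rw [this]
  exact h.biUnion fun a _ => List.finite_toSet a.toList

theorem nullsOf_mono {I J : Interpretation} (h : I ⊆ J) : nullsOf I ⊆ nullsOf J := by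
  rintro n ⟨a, ha, hn⟩
  exact ⟨a, h ha, hn⟩

/-- There are finitely many atoms over finitely many predicates and terms. -/
theorem finite_atoms {T : Type} {S : Set Predicate} {N : Set T} (hS : S.Finite) (hN : N.Finite) :
    {a : Atom T | a.pred ∈ S ∧ ∀ t ∈ a.toList, t ∈ N}.Finite := by
  have : {a : Atom T | a.pred ∈ S ∧ ∀ t ∈ a.toList, t ∈ N} ⊆
      ⋃ p ∈ S, (fun f : Fin p.arity → T => (⟨p, f⟩ : Atom T)) '' Set.pi Set.univ fun _ => N := by
    rintro ⟨p, f⟩ ⟨hp, hf⟩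
    simp only [Set.mem_iUnion]
    refine ⟨p, hp, f, fun i _ => hf _ (Atom.mem_toList.2 ⟨i, rfl⟩), rfl⟩
  exact (hS.biUnion fun p _ => (Set.Finite.pi' fun _ => hN).subset (by
    intro f hf i; exact hf i trivial) |>.image _).subset this

theorem finite_lists {T : Type} {N : Set T} (hN : N.Finite) (n : ℕ) :
    {l : List T | l.length = n ∧ ∀ t ∈ l, t ∈ N}.Finite := by
  have := finite_atoms (S := {⟨0, n⟩}) (Set.finite_singleton _) hN
  refine (this.image Atom.toList).subset ?_
  rintro l ⟨rfl, hl⟩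
  exact ⟨mkAtom 0 l, ⟨rfl, by simpa using hl⟩, by simp⟩

instance : Countable (Atom Var) :=
  Function.Injective.countable (f := fun a : Atom Var => (a.pred.name, a.toList)) fun a b h => by
    simp only [Prod.mk.injEq] at h
    exact Atom.ext_list h.1 h.2

instance : Countable Rule :=
  Function.Injective.countable (f := fun ρ : Rule => (ρ.body, ρ.head)) fun ρ τ h => by
    cases ρ; cases τ; simp_all

/-- An injective numbering of the rules. -/
noncomputable def Rule.code (ρ : Rule) : ℕ := (exists_injective_nat Rule).choose ρ

theorem Rule.code_injective : Function.Injective Rule.code := (exists_injective_nat Rule).choose_spec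

/-- A list of the variables of the body of a rule. -/
def Rule.bodyVars (ρ : Rule) : List Var := ρ.body.flatMap Atom.toList

theorem Rule.mem_bodyVars {ρ : Rule} {x : Var} : x ∈ ρ.bodyVars ↔ x ∈ varsOf ρ.body := by
  simp [Rule.bodyVars, mem_varsOf]

theorem Rule.eqOn_of_map_bodyVars {ρ : Rule} {σ τ : Var → Null}
    (h : ρ.bodyVars.map σ = ρ.bodyVars.map τ) : Set.EqOn σ τ (varsOf ρ.body) := by
  intro x hx
  rw [List.map_inj_left] at h
  exact h x (Rule.mem_bodyVars.2 hx)

theorem Rule.map_bodyVars {ρ : Rule} {σ τ : Var → Null}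
    (h : Set.EqOn σ τ (varsOf ρ.body)) : ρ.bodyVars.map σ = ρ.bodyVars.map τ := by
  rw [List.map_inj_left]
  exact fun x hx => h (Rule.mem_bodyVars.1 hx)

theorem headPredicates_finite {S : Set Rule} (hS : S.Finite) : (headPredicates S).Finite := by
  have : headPredicates S = ⋃ ρ ∈ S, {p | p ∈ ρ.head.flatten.map Atom.pred} := by
    ext p; simp [headPredicates]
  rw [this]
  exact hS.biUnion fun ρ _ => List.finite_toSet _

theorem bodyPredicates_finite {S : Set Rule} (hS : S.Finite) : (bodyPredicates S).Finite := by
  have : bodyPredicates S = ⋃ ρ ∈ S, {p | p ∈ ρ.body.map Atom.pred} := by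
    ext p; simp [bodyPredicates]
  rw [this]
  exact hS.biUnion fun ρ _ => List.finite_toSet _

/-! ### Branches and general properties of chase trees -/

namespace LabelledTree

variable {T : LabelledTree}

theorem mem_of_append {l v : List ℕ} (h : l ++ v ∈ T.nodes) : v ∈ T.nodes := by
  induction l with
  | nil => exact h
  | cons i l ih => exact ih (T.parent_mem i _ h)

theorem IsBranch.mem_of_append {P : Set (List ℕ)} (hP : T.IsBranch P) {l v : List ℕ}
    (h : l ++ v ∈ P) : v ∈ P := by
  induction l with
  | nil => exact h
  | cons i l ih => exact ih (hP.2.2.1 i _ h)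

theorem IsBranch.eq_of_length {P : Set (List ℕ)} (hP : T.IsBranch P) :
    ∀ {u v : List ℕ}, u ∈ P → v ∈ P → u.length = v.length → u = v
  | [], [], _, _, _ => rfl
  | i :: u, j :: v, hu, hv, h => by
    have := hP.eq_of_length (hP.2.2.1 i u hu) (hP.2.2.1 j v hv) (by simpa using h)
    subst this
    rw [hP.2.2.2.1 i j u hu hv]

theorem IsBranch.exists_append {P : Set (List ℕ)} (hP : T.IsBranch P) {u v : List ℕ}
    (hu : u ∈ P) (hv : v ∈ P) (h : v.length ≤ u.length) : ∃ l, u = l ++ v := by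
  refine ⟨u.take (u.length - v.length), ?_⟩
  have h1 := List.take_append_drop (u.length - v.length) u
  have h2 : u.drop (u.length - v.length) ∈ P := hP.mem_of_append (h1.symm ▸ hu)
  have h3 : u.drop (u.length - v.length) = v :=
    hP.eq_of_length h2 hv (by simp; omega)
  rw [h3] at h1
  exact h1.symm

end LabelledTree

namespace IsChaseTree

variable {S : Set Rule} {D : Interpretation} {T : LabelledTree}

theorem label_subset_child (hT : IsChaseTree S D T) {i : ℕ} {v : List ℕ} (h : i :: v ∈ T.nodes) :
    T.label v ⊆ T.label (i :: v) := by
  obtain ⟨ρ, -, σ, -, hc, hl⟩ := hT.2.1 v (T.parent_mem i v h) ⟨i, h⟩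
  obtain ⟨σ', -, he⟩ := hl i ((hc i).1 h)
  rw [he]
  exact Set.subset_union_left

theorem label_subset_append (hT : IsChaseTree S D T) {l v : List ℕ} (h : l ++ v ∈ T.nodes) :
    T.label v ⊆ T.label (l ++ v) := by
  induction l with
  | nil => exact subset_rfl
  | cons i l ih => exact (ih (T.parent_mem i _ h)).trans (hT.label_subset_child h)

theorem label_mono (hT : IsChaseTree S D T) {P : Set (List ℕ)} (hP : T.IsBranch P)
    {u v : List ℕ} (hu : u ∈ P) (hv : v ∈ P) (h : v.length ≤ u.length) :
    T.label v ⊆ T.label u := by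
  obtain ⟨l, rfl⟩ := hP.exists_append hu hv h
  exact hT.label_subset_append (hP.2.1 hu)

theorem exists_node_of_holds (hT : IsChaseTree S D T) {P : Set (List ℕ)} (hP : T.IsBranch P)
    {σ : Var → Null} {c : List (Atom Var)} (h : Holds σ c (⋃ v ∈ P, T.label v)) :
    ∃ v ∈ P, Holds σ c (T.label v) := by
  induction c with
  | nil => exact ⟨[], hP.1, by simp⟩
  | cons a c ih =>
    rw [holds_cons] at h
    obtain ⟨v, hv, hvc⟩ := ih h.2
    obtain ⟨u, hu, hua⟩ : ∃ u ∈ P, a.map σ ∈ T.label u := by simpa using h.1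
    rcases le_total u.length v.length with hl | hl
    · exact ⟨v, hv, holds_cons.2 ⟨hT.label_mono hP hv hu hl hua, hvc⟩⟩
    · exact ⟨u, hu, holds_cons.2 ⟨hua, hvc.mono (hT.label_mono hP hu hv hl)⟩⟩

/-- The elements of a chase result satisfy the rules. -/
theorem isModelOfRules (hT : IsChaseTree S D T) {I : Interpretation} (hI : I ∈ T.result) :
    IsModelOfRules I S := by
  obtain ⟨P, hP, rfl⟩ := hI
  intro ρ hρ σ hb
  obtain ⟨v, hv, hvb⟩ := hT.exists_node_of_holds hP hb
  obtain ⟨w, hw, hf⟩ := hT.2.2 P hP ρ hρ σ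
  obtain ⟨u, hu, hvu, hwu⟩ : ∃ u ∈ P, v.length ≤ u.length ∧ w.length ≤ u.length := by
    rcases le_total v.length w.length with h | h
    · exact ⟨w, hw, h, le_rfl⟩
    · exact ⟨v, hv, le_rfl, h⟩
  have := hf u hu hwu
  rw [Rule.Applicable, not_and, not_not] at this
  exact (this (hvb.mono (hT.label_mono hP hu hv hvu))).mono (Set.subset_biUnion_of_mem hu)

theorem subset_of_mem_result (hT : IsChaseTree S D T) {I : Interpretation} (hI : I ∈ T.result) :
    D ⊆ I := by
  obtain ⟨P, hP, rfl⟩ := hI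
  rw [← hT.1]
  exact Set.subset_biUnion_of_mem hP.1

/-- The label of a leaf belongs to the result. -/
theorem label_mem_result (hT : IsChaseTree S D T) {v : List ℕ} (hv : v ∈ T.nodes)
    (hleaf : ∀ i, i :: v ∉ T.nodes) : T.label v ∈ T.result := by
  -- Children prepend an index to the address, so the ancestors of `v` are its suffixes.
  refine ⟨{u | ∃ l, l ++ u = v}, ⟨⟨v, by simp⟩, ?_, ?_, ?_, ?_⟩, ?_⟩
  · rintro u ⟨l, rfl⟩
    exact LabelledTree.mem_of_append hv
  · rintro i u ⟨l, rfl⟩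
    exact ⟨l ++ [i], by simp⟩
  · rintro i j u ⟨l, h⟩ ⟨k, rfl⟩
    have h1 : (l ++ [i]) ++ u = (k ++ [j]) ++ u := by simpa using h
    have h2 := List.append_cancel_right h1
    have h3 := congrArg List.getLast? h2
    simpa using h3
  · rintro u ⟨l, rfl⟩ ⟨i, hi⟩
    rcases List.eq_nil_or_concat l with rfl | ⟨k, j, rfl⟩
    · exact absurd hi (hleaf i)
    · exact ⟨j, k, by simp⟩
  · apply subset_antisymm
    · exact Set.subset_biUnion_of_mem (u := T.label) (show v ∈ {u | ∃ l, l ++ u = v} from ⟨[], rfl⟩)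
    · refine Set.iUnion₂_subset ?_
      rintro u ⟨l, rfl⟩
      exact hT.label_subset_append hv

/-- Chase steps with existential rules preserve homomorphisms into models. -/
theorem exists_isHom_label (hT : IsChaseTree S D T) (hS : ∀ ρ ∈ S, ρ.IsExistential)
    {J : Interpretation} (hJ : IsModelOfRules J S) {h : Null → Null} (hh : IsHom h D J) :
    ∀ v ∈ T.nodes, ∃ h', IsHom h' (T.label v) J
  | [], _ => ⟨h, hT.1.symm ▸ hh⟩
  | i :: v, hv => by
    obtain ⟨f, hf⟩ := exists_isHom_label hT hS hJ hh v (T.parent_mem i v hv)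
    obtain ⟨ρ, hρ, σ, happ, hc, hl⟩ := hT.2.1 v (T.parent_mem i v hv) ⟨i, hv⟩
    have hi := (hc i).1 hv
    obtain ⟨τ, ⟨hτ1, hτ2, hτ3⟩, he⟩ := hl i hi
    have hlen : ρ.head.length = 1 := hS ρ hρ
    obtain ⟨η, hη, τ', hτ', hh'⟩ := hJ ρ hρ (fun x => f (σ x)) (by
      intro a ha
      exact hf _ (happ.1 a ha))
    have hη' : ρ.head[i] = η := by
      obtain ⟨j, hj, rfl⟩ := List.getElem_of_mem hη
      congr 1; omega
    rw [hη'] at hτ2 hτ3 he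
    classical
    -- A fresh null determines its existential variable because `τ` is injective on these; it is
    -- sent to the value of this variable in the match in `J`.
    let g : Null → Null := fun n =>
      if n ∈ nullsOf (T.label v) then f n
      else τ' (Function.invFunOn τ (varsOf η \ varsOf ρ.body) n)
    refine ⟨g, ?_⟩
    rw [he]
    rintro b (hb | ⟨a, ha, rfl⟩)
    · have : b.map g = b.map f := Atom.map_congr fun t ht => by
        simp only [g, if_pos (mem_nullsOf.2 ⟨b, hb, ht⟩)]
      rw [this]
      exact hf b hb
    · have : (a.map τ).map g = a.map τ' := by
        rw [Atom.map_map]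
        refine Atom.map_congr fun t ht => ?_
        by_cases htb : t ∈ varsOf ρ.body
        · have : σ t ∈ nullsOf (T.label v) := by
            obtain ⟨c, hcb, htc⟩ := mem_varsOf.1 htb
            exact mem_nullsOf.2 ⟨c.map σ, happ.1 c hcb, by simpa using ⟨t, htc, rfl⟩⟩
          simp only [g, hτ1 htb, if_pos this]
          exact (hτ' htb).symm
        · have hm : t ∈ varsOf η \ varsOf ρ.body := ⟨mem_varsOf.2 ⟨a, ha, ht⟩, htb⟩
          simp only [g, if_neg (hτ3 t hm)]
          rw [hτ2.leftInvOn_invFunOn hm]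
      rw [this]
      exact hh' a ha

end IsChaseTree

/-! ### Existence of fair chase trees -/

theorem exists_fresh_extension (ρ : Rule) (η : List (Atom Var)) {E : Interpretation}
    (hE : E.Finite) (σ : Var → Null) : ∃ σ', ρ.IsFreshExtension η E σ σ' := by
  classical
  obtain ⟨b, hb⟩ := (nullsOf_finite hE).bddAbove
  -- All nulls of `E` are at most `b`, so `b + 1 + y` is fresh, and it is injective in `y`.
  refine ⟨fun y => if y ∈ varsOf ρ.body then σ y else b + 1 + y, ?_, ?_, ?_⟩
  · intro x hx; simp [hx]
  · intro x hx y hy h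
    simpa [hx.2, hy.2] using h
  · intro y hy h
    have : b + 1 + y ≤ b := by simpa [hy.2] using hb h
    exact Nat.not_lt.2 this (Nat.lt_of_lt_of_le (Nat.lt_succ_self b) (Nat.le_add_right _ _))

/-- A number that determines a rule and the values of a substitution on its body variables. -/
noncomputable def Rule.priority (ρ : Rule) (σ : Var → Null) : ℕ :=
  Nat.pair ρ.code (Encodable.encode (ρ.bodyVars.map σ))

theorem Rule.eq_of_priority_eq {ρ τ : Rule} {σ υ : Var → Null}
    (h : ρ.priority σ = τ.priority υ) : ρ = τ ∧ Set.EqOn σ υ (varsOf ρ.body) := by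
  obtain ⟨h1, h2⟩ := Nat.pair_eq_pair.1 h
  have h3 := Rule.code_injective h1
  subst h3
  exact ⟨rfl, Rule.eqOn_of_map_bodyVars (Encodable.encode_injective h2)⟩

theorem finite_instance (c : List (Atom Var)) (σ : Var → Null) :
    {b | ∃ a ∈ c, b = a.map σ}.Finite := by
  refine ((List.finite_toSet c).image (fun a => a.map σ)).subset ?_
  rintro b ⟨a, ha, rfl⟩
  exact ⟨a, ha, rfl⟩

/-- Every rule set and every database have a chase tree. -/
theorem exists_isChaseTree (S : Set Rule) {D : Interpretation} (hD : D.Finite) :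
    ∃ T, IsChaseTree S D T := by
  classical
  -- The tree always applies an applicable pair of least priority, which makes it fair. If nothing
  -- is applicable, the selected pair is an arbitrary default.
  have hsel : ∀ E : Interpretation, ∃ p : Rule × (Var → Null),
      (∃ ρ ∈ S, ∃ σ, ρ.Applicable σ E) → p.1 ∈ S ∧ p.1.Applicable p.2 E ∧
        ∀ ρ ∈ S, ∀ σ, ρ.Applicable σ E → p.1.priority p.2 ≤ ρ.priority σ := by
    intro E
    by_cases h : ∃ ρ ∈ S, ∃ σ, ρ.Applicable σ E
    · have hex : ∃ n, ∃ ρ ∈ S, ∃ σ, ρ.Applicable σ E ∧ ρ.priority σ = n := by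
        obtain ⟨ρ, hρ, σ, hσ⟩ := h
        exact ⟨_, ρ, hρ, σ, hσ, rfl⟩
      obtain ⟨ρ, hρ, σ, hσ, he⟩ := Nat.find_spec hex
      refine ⟨(ρ, σ), fun _ => ⟨hρ, hσ, fun τ hτ υ hυ => ?_⟩⟩
      rw [he]
      exact Nat.find_min' hex ⟨τ, hτ, υ, hυ, rfl⟩
    · obtain ⟨ρ⟩ : Nonempty Rule := ⟨⟨[], [[mkAtom 0 []]], by simp, by simp⟩⟩
      exact ⟨(ρ, fun _ => 0), fun h' => absurd h' h⟩
  choose sel hsel using hsel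
  have hfr : ∀ (ρ : Rule) (η : List (Atom Var)) (E : Interpretation) (σ : Var → Null),
      ∃ σ', E.Finite → ρ.IsFreshExtension η E σ σ' := by
    intro ρ η E σ
    by_cases hE : E.Finite
    · obtain ⟨σ', h⟩ := exists_fresh_extension ρ η hE σ
      exact ⟨σ', fun _ => h⟩
    · exact ⟨σ, fun h => absurd h hE⟩
  choose fr hfr using hfr
  let ext : Interpretation → ℕ → Interpretation := fun E i =>
    E ∪ {b | ∃ a ∈ (sel E).1.head.getD i [],
      b = a.map (fr (sel E).1 ((sel E).1.head.getD i []) E (sel E).2)}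
  let label : List ℕ → Interpretation := fun v => List.rec D (fun i _ E => ext E i) v
  let nodes : List ℕ → Prop := fun v => List.rec True (fun i v N => N ∧
    (∃ ρ ∈ S, ∃ σ, ρ.Applicable σ (label v)) ∧ i < (sel (label v)).1.head.length) v
  let T : LabelledTree := ⟨{v | nodes v}, trivial, fun i v h => h.1, label⟩
  have hmem : ∀ i v, i :: v ∈ T.nodes ↔ v ∈ T.nodes ∧
    (∃ ρ ∈ S, ∃ σ, ρ.Applicable σ (T.label v)) ∧ i < (sel (T.label v)).1.head.length :=
    fun i v => Iff.rfl
  have hlab : ∀ i v, T.label (i :: v) = ext (T.label v) i := fun i v => rfl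
  have hfin : ∀ v, (T.label v).Finite := by
    intro v
    induction v with
    | nil => exact hD
    | cons i v ih =>
      rw [hlab]
      exact ih.union (finite_instance _ _)
  have hstep : ∀ v ∈ T.nodes, (∃ ρ ∈ S, ∃ σ, ρ.Applicable σ (T.label v)) →
      T.IsRuleApplication v (sel (T.label v)).1 (sel (T.label v)).2 := by
    intro v hv ha
    refine ⟨(hsel _ ha).2.1, fun i => ?_, fun i hi => ?_⟩
    · rw [hmem]; tauto
    · refine ⟨fr (sel (T.label v)).1 ((sel (T.label v)).1.head.getD i []) (T.label v)
        (sel (T.label v)).2, ?_, ?_⟩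
      · have := hfr (sel (T.label v)).1 ((sel (T.label v)).1.head.getD i []) (T.label v)
          (sel (T.label v)).2 (hfin v)
        have e : (sel (T.label v)).1.head.getD i [] = (sel (T.label v)).1.head[i] := by simp [hi]
        rwa [e] at this ⊢
      · have e : (sel (T.label v)).1.head.getD i [] = (sel (T.label v)).1.head[i] := by simp [hi]
        rw [hlab, ← e]
  have hmono : ∀ i v, T.label v ⊆ T.label (i :: v) := fun i v => by
    rw [hlab]; exact Set.subset_union_left
  refine ⟨T, rfl, ?_, ?_⟩
  · rintro v hv ⟨i, hi⟩
    have ha := ((hmem i v).1 hi).2.1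
    exact ⟨_, (hsel _ ha).1, _, hstep v hv ha⟩
  · intro P hP ρ hρ σ
    by_contra! hcon
    have hmonoP : ∀ u ∈ P, ∀ v ∈ P, v.length ≤ u.length → T.label v ⊆ T.label u := by
      intro u hu v hv h
      obtain ⟨l, rfl⟩ := hP.exists_append hu hv h
      clear h hu
      induction l with
      | nil => exact subset_rfl
      | cons i l ih => exact ih.trans (hmono i _)
    -- once applicable, the pair stays applicable
    obtain ⟨v₀, hv₀, -, happ₀⟩ := hcon [] hP.1
    have happ : ∀ u ∈ P, v₀.length ≤ u.length → ρ.Applicable σ (T.label u) := by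
      intro u hu hl
      obtain ⟨w, hw, hwl, hwa⟩ := hcon u hu
      exact ⟨happ₀.1.mono (hmonoP u hu v₀ hv₀ hl),
        fun hh => hwa.2 (hh.mono (hmonoP w hw u hu hwl))⟩
    have hnext : ∀ u ∈ P, v₀.length ≤ u.length → ∃ i, i :: u ∈ P := by
      intro u hu hl
      have ha : ∃ ρ ∈ S, ∃ σ, ρ.Applicable σ (T.label u) := ⟨ρ, hρ, σ, happ u hu hl⟩
      refine hP.2.2.2.2 u hu ⟨0, (hmem 0 u).2 ⟨hP.2.1 hu, ha, ?_⟩⟩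
      exact List.length_pos_of_ne_nil (sel (T.label u)).1.head_ne_nil
    have hseq : ∀ n, ∃ u ∈ P, u.length = v₀.length + n := by
      intro n
      induction n with
      | zero => exact ⟨v₀, hv₀, rfl⟩
      | succ n ih =>
        obtain ⟨u, hu, hl⟩ := ih
        obtain ⟨i, hi⟩ := hnext u hu (by omega)
        exact ⟨_, hi, by simp [hl]; omega⟩
    choose s hsP hsl using hseq
    let k : ℕ → ℕ := fun n => (sel (T.label (s n))).1.priority (sel (T.label (s n))).2
    have hsa : ∀ n, ∃ ρ ∈ S, ∃ σ, ρ.Applicable σ (T.label (s n)) := fun n =>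
      ⟨ρ, hρ, σ, happ _ (hsP n) (by rw [hsl]; omega)⟩
    have hle : ∀ n, k n ≤ ρ.priority σ := fun n =>
      (hsel _ (hsa n)).2.2 ρ hρ σ (happ _ (hsP n) (by rw [hsl]; omega))
    -- Once a pair has been applied, its head holds forever and it is never selected again. Thus
    -- infinitely many distinct priorities would lie below that of the pair that stays applicable.
    have hne : ∀ m n, m < n → k m ≠ k n := by
      intro m n hmn heq
      obtain ⟨h1, h2⟩ := Rule.eq_of_priority_eq heq
      obtain ⟨i, hi⟩ := hnext (s m) (hsP m) (by rw [hsl]; omega)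
      obtain ⟨-, hc, hl⟩ := hstep _ (hP.2.1 (hsP m)) (hsa m)
      have hi' := (hc i).1 (hP.2.1 hi)
      obtain ⟨τ, hτ, he⟩ := hl i hi'
      have hh : (sel (T.label (s m))).1.HeadHolds (sel (T.label (s m))).2 (T.label (i :: s m)) := by
        refine ⟨_, List.getElem_mem hi', τ, hτ.1, ?_⟩
        intro a ha
        rw [he]
        exact Or.inr ⟨a, ha, rfl⟩
      have hsub := hmonoP (s n) (hsP n) (i :: s m) hi (by simp [hsl]; omega)
      have hn := (hsel _ (hsa n)).2.1.2
      rw [← h1] at hn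
      exact hn ((hh.mono hsub).congr h2)
    have hinj : Function.Injective k := by
      intro m n h
      rcases lt_trichotomy m n with hlt | rfl | hlt
      · exact absurd h (hne m n hlt)
      · rfl
      · exact absurd h.symm (hne n m hlt)
    exact (Set.infinite_range_of_injective hinj)
      ((Set.finite_Iic (ρ.priority σ)).subset (by rintro _ ⟨n, rfl⟩; exact hle n))

/-! ### Encoding of worlds and layers -/

/-- An atom with a new predicate: the names below `K` are left to the given predicates. -/
def newAtom {T : Type} (K i j : ℕ) (l : List T) : Atom T := mkAtom (K + Nat.pair i j) l

@[simp] theorem newAtom_inj {T : Type} {K i j i' j' : ℕ} {l l' : List T} :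
    newAtom K i j l = newAtom K i' j' l' ↔ i = i' ∧ j = j' ∧ l = l' := by
  simp [newAtom, mkAtom_inj, Nat.pair_eq_pair, and_assoc]

@[simp] theorem newAtom_map {T U : Type} (f : T → U) (K i j : ℕ) (l : List T) :
    (newAtom K i j l).map f = newAtom K i j (l.map f) := mkAtom_map f _ l

@[simp] theorem newAtom_toList {T : Type} (K i j : ℕ) (l : List T) :
    (newAtom K i j l).toList = l := mkAtom_toList _ l

theorem le_newAtom_name {T : Type} (K i j : ℕ) (l : List T) :
    K ≤ (newAtom K i j l).pred.name := Nat.le_add_right _ _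

/-- World `w'` results from world `w` by the disjunct with code `c`, instantiated with `x`. -/
abbrev insA {T : Type} (K c : ℕ) (w w' : T) (x : List T) : Atom T := newAtom K 2 c (w :: w' :: x)

/-- World `w` is contained in world `w'`. -/
abbrev subsA {T : Type} (K : ℕ) (w w' : T) : Atom T := newAtom K 3 0 [w, w']

/-- World `w` contains everything that it should. -/
abbrev doneA {T : Type} (K : ℕ) (w : T) : Atom T := newAtom K 4 0 [w]

/-- World `w` is the root world. -/
abbrev emptyA {T : Type} (K : ℕ) (w : T) : Atom T := newAtom K 5 0 [w]

/-- The goal follows in all completions of world `w`. -/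
abbrev accA {T : Type} (K : ℕ) (w : T) : Atom T := newAtom K 6 0 [w]

open Classical in
/-- The atom `a` in layer `l` of world `w`; atoms with predicates in `P` do not depend on worlds. -/
noncomputable def Atom.inWorld {T : Type} (P : Set Predicate) (K l : ℕ) (w : T) (a : Atom T) :
    Atom T :=
  if a.pred ∈ P then a else newAtom K l a.pred.name (w :: a.toList)

theorem Atom.inWorld_map {T U : Type} (f : T → U) (P : Set Predicate) (K l : ℕ) (w : T)
    (a : Atom T) : (a.inWorld P K l w).map f = (a.map f).inWorld P K l (f w) := by
  by_cases h : a.pred ∈ P <;> simp [Atom.inWorld, h]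

theorem Atom.inWorld_of_mem {T : Type} {P : Set Predicate} {K l : ℕ} {w : T} {a : Atom T}
    (h : a.pred ∈ P) : a.inWorld P K l w = a := if_pos h

theorem Atom.inWorld_of_notMem {T : Type} {P : Set Predicate} {K l : ℕ} {w : T} {a : Atom T}
    (h : a.pred ∉ P) : a.inWorld P K l w = newAtom K l a.pred.name (w :: a.toList) := if_neg h

/-- The contents of layer `l` of world `w` in `E`. -/
def view (P : Set Predicate) (K l : ℕ) (w : Null) (E : Interpretation) : Interpretation :=
  {a | a.inWorld P K l w ∈ E}

theorem mem_view {P : Set Predicate} {K l : ℕ} {w : Null} {E : Interpretation} {a : Atom Null} :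
    a ∈ view P K l w E ↔ a.inWorld P K l w ∈ E := Iff.rfl

theorem view_mono {P : Set Predicate} {K l : ℕ} {w : Null} {E F : Interpretation} (h : E ⊆ F) :
    view P K l w E ⊆ view P K l w F := fun _ ha => h ha

/-- The renaming of the original variables; odd variables stand for worlds. -/
def dbl (x : Var) : Var := 2 * x

theorem dbl_injective : Function.Injective dbl := fun x y h => by
  have : 2 * x = 2 * y := h
  exact Nat.eq_of_mul_eq_mul_left two_pos this

theorem dbl_ne (x n : ℕ) : dbl x ≠ 2 * n + 1 := by
  intro h
  have h' : @Eq ℕ (2 * x) (2 * n + 1) := h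
  omega

/-- A conjunction in layer `l` of the world denoted by the variable `v`. -/
noncomputable def conjInWorld (P : Set Predicate) (K l : ℕ) (v : Var) (c : List (Atom Var)) :
    List (Atom Var) :=
  c.map fun a => (a.map dbl).inWorld P K l v

@[simp] theorem holds_conjInWorld {P : Set Predicate} {K l : ℕ} {v : Var} {c : List (Atom Var)}
    {σ : Var → Null} {E : Interpretation} :
    Holds σ (conjInWorld P K l v c) E ↔ Holds (σ ∘ dbl) c (view P K l (σ v) E) := by
  simp only [Holds, conjInWorld, List.mem_map, forall_exists_index, and_imp,
    forall_apply_eq_imp_iff₂, Atom.inWorld_map, mem_view]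
  rfl

theorem mem_varsOf_conjInWorld {P : Set Predicate} {K l : ℕ} {v : Var} {c : List (Atom Var)}
    {y : Var} (h : y ∈ varsOf (conjInWorld P K l v c)) : y = v ∨ ∃ x ∈ varsOf c, y = dbl x := by
  obtain ⟨b, hb, hy⟩ := mem_varsOf.1 h
  obtain ⟨a, ha, rfl⟩ := List.mem_map.1 hb
  by_cases hp : a.pred ∈ P
  · rw [Atom.inWorld_of_mem (by simpa using hp)] at hy
    obtain ⟨x, hx, rfl⟩ := by simpa using hy
    exact Or.inr ⟨x, mem_varsOf.2 ⟨a, ha, hx⟩, rfl⟩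
  · rw [Atom.inWorld_of_notMem (by simpa using hp)] at hy
    simp only [Atom.toList_map, newAtom_toList, List.mem_cons, List.mem_map] at hy
    rcases hy with rfl | ⟨x, hx, rfl⟩
    · exact Or.inl rfl
    · exact Or.inr ⟨x, mem_varsOf.2 ⟨a, ha, hx⟩, rfl⟩

theorem dbl_mem_varsOf_conjInWorld {P : Set Predicate} {K l : ℕ} {v : Var} {c : List (Atom Var)}
    {x : Var} (h : x ∈ varsOf c) : dbl x ∈ varsOf (conjInWorld P K l v c) := by
  obtain ⟨a, ha, hx⟩ := mem_varsOf.1 h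
  refine mem_varsOf.2 ⟨_, List.mem_map_of_mem ha, ?_⟩
  by_cases hp : a.pred ∈ P
  · rw [Atom.inWorld_of_mem (by simpa using hp)]
    simpa using ⟨x, hx, rfl⟩
  · rw [Atom.inWorld_of_notMem (by simpa using hp)]
    simpa using Or.inr ⟨x, hx, rfl⟩

/-- The substitution with values `σ` on original variables and values `ω` on world variables. -/
def glue (σ : Var → Null) (ω : ℕ → Null) : Var → Null :=
  fun n => if n % 2 = 0 then σ (n / 2) else ω (n / 2)

@[simp] theorem glue_dbl (σ : Var → Null) (ω : ℕ → Null) (x : Var) : glue σ ω (dbl x) = σ x := by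
  have : dbl x = 2 * x := rfl
  simp [glue, this]

@[simp] theorem glue_comp_dbl (σ : Var → Null) (ω : ℕ → Null) : glue σ ω ∘ dbl = σ :=
  funext fun x => glue_dbl σ ω x

theorem glue_odd (σ : Var → Null) (ω : ℕ → Null) (n : ℕ) : glue σ ω (2 * n + 1) = ω n := by
  have h1 : (2 * n + 1) % 2 = 1 := by omega
  have h2 : (2 * n + 1) / 2 = n := by omega
  simp [glue, h1, h2]

@[simp] theorem glue_one (σ : Var → Null) (ω : ℕ → Null) : glue σ ω 1 = ω 0 := glue_odd σ ω 0
@[simp] theorem glue_three (σ : Var → Null) (ω : ℕ → Null) : glue σ ω 3 = ω 1 := glue_odd σ ω 1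
@[simp] theorem glue_five (σ : Var → Null) (ω : ℕ → Null) : glue σ ω 5 = ω 2 := glue_odd σ ω 2

/-- The existential rule with body `b` and head `a ∧ c`. -/
def exRule (b : List (Atom Var)) (a : Atom Var) (c : List (Atom Var)) : Rule :=
  ⟨b, [a :: c], by simp, by simp⟩

theorem exRule_headHolds {b : List (Atom Var)} {a : Atom Var} {c : List (Atom Var)}
    {σ : Var → Null} {E : Interpretation} : (exRule b a c).HeadHolds σ E ↔
      ∃ σ', Set.EqOn σ' σ (varsOf b) ∧ Holds σ' (a :: c) E := by
  simp [Rule.HeadHolds, exRule]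

theorem exRule_headHolds_of_subset {b : List (Atom Var)} {a : Atom Var} {c : List (Atom Var)}
    (h : varsOf (a :: c) ⊆ varsOf b) {σ : Var → Null} {E : Interpretation} :
    (exRule b a c).HeadHolds σ E ↔ Holds σ (a :: c) E := by
  rw [exRule_headHolds]
  exact ⟨fun ⟨σ', he, hh⟩ => hh.congr (he.mono h).symm, fun hh => ⟨σ, fun _ _ => rfl, hh⟩⟩

/-- The code of the `i`-th disjunct of a rule. -/
noncomputable def Rule.disjCode (ρ : Rule) (i : ℕ) : ℕ := Nat.pair ρ.code i

theorem Rule.disjCode_inj {ρ τ : Rule} {i j : ℕ} (h : ρ.disjCode i = τ.disjCode j) :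
    ρ = τ ∧ i = j := by
  obtain ⟨h1, h2⟩ := Nat.pair_eq_pair.1 h
  exact ⟨Rule.code_injective h1, h2⟩

/-- The `i`-th disjunct of a rule. -/
def Rule.disj (ρ : Rule) (i : ℕ) : List (Atom Var) := ρ.head.getD i []

theorem Rule.disj_eq {ρ : Rule} {i : ℕ} (h : i < ρ.head.length) : ρ.disj i = ρ.head[i] := by
  simp [Rule.disj, h]

/-! ### The simulating rules -/

section Rules

variable (P : Set Predicate) (K : ℕ)

/-- There is a root world. -/
def rootRule : Rule := exRule [] (emptyA K 1) [subsA K 1 1]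

/-- For every match of the body of `ρ` in a world, there is a world for its `i`-th disjunct. -/
noncomputable def branchRule (ρ : Rule) (i : ℕ) : Rule :=
  exRule (doneA K 1 :: conjInWorld P K 0 1 ρ.body)
    (insA K (ρ.disjCode i) 1 3 (ρ.bodyVars.map dbl)) [subsA K 3 3]

/-- The disjunct instances of a world are inherited by the worlds that contain it. -/
noncomputable def inheritRule (ρ : Rule) (i : ℕ) : Rule :=
  exRule [insA K (ρ.disjCode i) 1 3 (ρ.bodyVars.map dbl), subsA K 3 5]
    (insA K (ρ.disjCode i) 5 5 (ρ.bodyVars.map dbl))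
    (subsA K 1 5 :: (conjInWorld P K 0 5 (ρ.disj i) ++ conjInWorld P K 1 5 (ρ.disj i)))

/-- A world that contains the root world is complete. -/
def doneRule : Rule := exRule [emptyA K 1, subsA K 1 3] (doneA K 3) []

/-- The rule `ρ` in layer 1 of complete worlds. -/
noncomputable def simRule (ρ : Rule) : Rule where
  body := doneA K 1 :: conjInWorld P K 1 1 ρ.body
  head := ρ.head.map (conjInWorld P K 1 1)
  head_ne_nil := by simpa using ρ.head_ne_nil
  disjunct_ne_nil := by
    simp only [List.mem_map, forall_exists_index, and_imp, forall_apply_eq_imp_iff₂]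
    intro η hη
    simpa [conjInWorld] using ρ.disjunct_ne_nil η hη

/-- Worlds that contain the goal are accepted. -/
def goalRule (goal : Predicate) : Rule := exRule [newAtom K 1 goal.name [1]] (accA K 1) []

/-- Worlds are accepted if all worlds for the disjuncts of `ρ` are. -/
noncomputable def acceptRule (ρ : Rule) : Rule :=
  exRule (doneA K 1 :: (conjInWorld P K 0 1 ρ.body ++ (List.range ρ.head.length).flatMap fun i =>
    [insA K (ρ.disjCode i) 1 (2 * (i + 1) + 1) (ρ.bodyVars.map dbl), accA K (2 * (i + 1) + 1)]))
    (accA K 1) []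

/-- The goal follows if the root world is accepted. -/
def finalRule (goal : Predicate) : Rule := exRule [emptyA K 1, accA K 1] (mkAtom goal.name []) []

/-- The existential rules that simulate the split `⟨S₁, S₂⟩`. -/
def worldRules (goal : Predicate) (S₁ S₂ : Set Rule) : Set Rule :=
  {rootRule K, doneRule K, goalRule K goal, finalRule K goal} ∪
    (⋃ ρ ∈ S₁, insert (acceptRule P K ρ) (⋃ i ∈ Set.Iio ρ.head.length,
      {branchRule P K ρ i, inheritRule P K ρ i})) ∪ simRule P K '' S₂

variable {P K} {σ : Var → Null} {E : Interpretation}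

theorem worldRules_finite (goal : Predicate) {S₁ S₂ : Set Rule} (h₁ : S₁.Finite)
    (h₂ : S₂.Finite) : (worldRules P K goal S₁ S₂).Finite := by
  refine ((Set.toFinite _).union (h₁.biUnion fun ρ _ => Set.Finite.insert _
    ((Set.finite_Iio _).biUnion fun i _ => Set.toFinite _))).union (h₂.image _)

theorem mem_worldRules {goal : Predicate} {S₁ S₂ : Set Rule} {ρ : Rule} :
    ρ ∈ worldRules P K goal S₁ S₂ ↔ ρ = rootRule K ∨ ρ = doneRule K ∨ ρ = goalRule K goal ∨
      ρ = finalRule K goal ∨ (∃ τ ∈ S₁, ρ = acceptRule P K τ) ∨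
      (∃ τ ∈ S₁, ∃ i < τ.head.length, ρ = branchRule P K τ i) ∨
      (∃ τ ∈ S₁, ∃ i < τ.head.length, ρ = inheritRule P K τ i) ∨
      ∃ τ ∈ S₂, ρ = simRule P K τ := by
  simp only [worldRules, Set.mem_union, Set.mem_insert_iff, Set.mem_singleton_iff, Set.mem_iUnion,
    Set.mem_Iio, Set.mem_image, exists_prop]
  constructor
  · rintro ((h | ⟨τ, hτ, h | ⟨i, hi, h | h⟩⟩) | ⟨τ, hτ, rfl⟩)
    · tauto
    · exact Or.inr (Or.inr (Or.inr (Or.inr (Or.inl ⟨τ, hτ, h⟩))))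
    · exact Or.inr (Or.inr (Or.inr (Or.inr (Or.inr (Or.inl ⟨τ, hτ, i, hi, h⟩)))))
    · exact Or.inr (Or.inr (Or.inr (Or.inr (Or.inr (Or.inr (Or.inl ⟨τ, hτ, i, hi, h⟩))))))
    · exact Or.inr (Or.inr (Or.inr (Or.inr (Or.inr (Or.inr (Or.inr ⟨τ, hτ, rfl⟩))))))
  · rintro (h | h | h | h | ⟨τ, hτ, h⟩ | ⟨τ, hτ, i, hi, h⟩ | ⟨τ, hτ, i, hi, h⟩ | ⟨τ, hτ, rfl⟩)
    · tauto
    · tauto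
    · tauto
    · tauto
    · exact Or.inl (Or.inr ⟨τ, hτ, Or.inl h⟩)
    · exact Or.inl (Or.inr ⟨τ, hτ, Or.inr ⟨i, hi, Or.inl h⟩⟩)
    · exact Or.inl (Or.inr ⟨τ, hτ, Or.inr ⟨i, hi, Or.inr h⟩⟩)
    · exact Or.inr ⟨τ, hτ, rfl⟩

theorem worldRules_isExistential {goal : Predicate} {S₁ S₂ : Set Rule}
    (h₂ : ∀ ρ ∈ S₂, ρ.IsExistential) : ∀ ρ ∈ worldRules P K goal S₁ S₂, ρ.IsExistential := by
  intro ρ hρ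
  rcases mem_worldRules.1 hρ with rfl | rfl | rfl | rfl | ⟨τ, hτ, rfl⟩ | ⟨τ, hτ, i, hi, rfl⟩ |
    ⟨τ, hτ, i, hi, rfl⟩ | ⟨τ, hτ, rfl⟩
  iterate 7 exact rfl
  simpa [Rule.IsExistential, simRule] using h₂ τ hτ

theorem rootRule_headHolds : (rootRule K).HeadHolds σ E ↔
    ∃ w, emptyA K w ∈ E ∧ subsA K w w ∈ E := by
  rw [rootRule, exRule_headHolds]
  constructor
  · rintro ⟨σ', -, h⟩
    exact ⟨σ' 1, by simpa using h⟩
  · rintro ⟨w, h⟩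
    exact ⟨fun _ => w, by simp [Set.EqOn], by simpa using h⟩

theorem branchRule_body {ρ : Rule} {i : ℕ} : Holds σ (branchRule P K ρ i).body E ↔
    doneA K (σ 1) ∈ E ∧ Holds (σ ∘ dbl) ρ.body (view P K 0 (σ 1) E) := by
  simp [branchRule, exRule]

/-- The witness `w` may be the world `σ 1` itself. A complete world that already contains the
instance therefore blocks the rule, which bounds the number of worlds. -/
theorem branchRule_headHolds {ρ : Rule} {i : ℕ} : (branchRule P K ρ i).HeadHolds σ E ↔
    ∃ w, insA K (ρ.disjCode i) (σ 1) w (ρ.bodyVars.map (σ ∘ dbl)) ∈ E ∧ subsA K w w ∈ E := by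
  rw [branchRule, exRule_headHolds]
  constructor
  · rintro ⟨σ', he, h⟩
    refine ⟨σ' 3, ?_⟩
    have h1 : σ' 1 = σ 1 := he (by simp)
    have h2 : ρ.bodyVars.map (σ ∘ dbl) = ρ.bodyVars.map (σ' ∘ dbl) :=
      Rule.map_bodyVars fun x hx =>
        (he (by simp [dbl_mem_varsOf_conjInWorld hx])).symm
    rw [h2, ← h1]
    simpa using h
  · rintro ⟨w, h⟩
    refine ⟨Function.update σ 3 w, ?_, ?_⟩
    · intro y hy
      refine Function.update_of_ne ?_ _ _
      rintro rfl
      simp only [mem_varsOf_cons, newAtom_toList, List.mem_singleton] at hy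
      rcases hy with hy | hy
      · exact absurd hy (by decide)
      · rcases mem_varsOf_conjInWorld hy with hy | ⟨x, -, hx⟩
        · exact absurd hy (by decide)
        · exact dbl_ne x 1 hx.symm
    · have h2 : ρ.bodyVars.map (Function.update σ 3 w ∘ dbl) = ρ.bodyVars.map (σ ∘ dbl) := by
        rw [List.map_inj_left]
        intro x _
        exact Function.update_of_ne (dbl_ne x 1) _ _
      have h1 : Function.update σ 3 w 1 = σ 1 := Function.update_of_ne (by decide) _ _
      simp only [holds_cons, newAtom_map, List.map_cons, List.map_map, h1, h2, holds_nil, and_true,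
        Function.update_self, List.map_nil]
      exact h

theorem inheritRule_body {ρ : Rule} {i : ℕ} : Holds σ (inheritRule P K ρ i).body E ↔
    insA K (ρ.disjCode i) (σ 1) (σ 3) (ρ.bodyVars.map (σ ∘ dbl)) ∈ E ∧
      subsA K (σ 3) (σ 5) ∈ E := by
  simp [inheritRule, exRule]

theorem inheritRule_vars {ρ : Rule} (hρ : ρ.IsDisjunctiveDatalog) {i : ℕ}
    (hi : i < ρ.head.length) : ∀ η ∈ (inheritRule P K ρ i).head,
      varsOf η ⊆ varsOf (inheritRule P K ρ i).body := by
  intro η hη y hy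
  simp only [inheritRule, exRule, List.mem_singleton] at hη
  subst hη
  have key : ∀ l, y ∈ varsOf (conjInWorld P K l 5 (ρ.disj i)) →
      y = 5 ∨ y ∈ ρ.bodyVars.map dbl := by
    intro l h
    rcases mem_varsOf_conjInWorld h with h | ⟨x, hx, rfl⟩
    · exact Or.inl h
    · rw [Rule.disj_eq hi] at hx
      exact Or.inr (List.mem_map_of_mem
        (Rule.mem_bodyVars.2 (hρ _ (List.getElem_mem hi) hx)))
  have h0 := key 0
  have h1 := key 1
  simp only [mem_varsOf_cons, mem_varsOf_append, newAtom_toList, List.mem_cons] at hy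
  simp only [inheritRule, exRule, mem_varsOf_cons, newAtom_toList, List.mem_cons]
  tauto

theorem inheritRule_headHolds {ρ : Rule} (hρ : ρ.IsDisjunctiveDatalog) {i : ℕ}
    (hi : i < ρ.head.length) : (inheritRule P K ρ i).HeadHolds σ E ↔
      insA K (ρ.disjCode i) (σ 5) (σ 5) (ρ.bodyVars.map (σ ∘ dbl)) ∈ E ∧
      subsA K (σ 1) (σ 5) ∈ E ∧ Holds (σ ∘ dbl) (ρ.disj i) (view P K 0 (σ 5) E) ∧
      Holds (σ ∘ dbl) (ρ.disj i) (view P K 1 (σ 5) E) := by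
  have := inheritRule_vars (P := P) (K := K) hρ hi
  simp only [inheritRule, exRule, List.mem_singleton, forall_eq] at this
  rw [inheritRule, exRule_headHolds_of_subset this]
  simp

theorem doneRule_body : Holds σ (doneRule K).body E ↔
    emptyA K (σ 1) ∈ E ∧ subsA K (σ 1) (σ 3) ∈ E := by
  simp [doneRule, exRule]

theorem doneRule_headHolds : (doneRule K).HeadHolds σ E ↔ doneA K (σ 3) ∈ E := by
  rw [doneRule, exRule_headHolds_of_subset]
  · simp
  · intro x; simp; tauto

theorem goalRule_body {goal : Predicate} : Holds σ (goalRule K goal).body E ↔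
    newAtom K 1 goal.name [σ 1] ∈ E := by
  simp [goalRule, exRule]

theorem goalRule_headHolds {goal : Predicate} :
    (goalRule K goal).HeadHolds σ E ↔ accA K (σ 1) ∈ E := by
  rw [goalRule, exRule_headHolds_of_subset]
  · simp
  · intro x; simp

theorem finalRule_body {goal : Predicate} : Holds σ (finalRule K goal).body E ↔
    emptyA K (σ 1) ∈ E ∧ accA K (σ 1) ∈ E := by
  simp [finalRule, exRule]

theorem finalRule_headHolds {goal : Predicate} :
    (finalRule K goal).HeadHolds σ E ↔ mkAtom goal.name [] ∈ E := by
  rw [finalRule, exRule_headHolds_of_subset]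
  · simp [mkAtom_map]
  · intro x; simp

theorem acceptRule_body {ρ : Rule} : Holds σ (acceptRule P K ρ).body E ↔
    doneA K (σ 1) ∈ E ∧ Holds (σ ∘ dbl) ρ.body (view P K 0 (σ 1) E) ∧
    ∀ i < ρ.head.length, insA K (ρ.disjCode i) (σ 1) (σ (2 * (i + 1) + 1))
      (ρ.bodyVars.map (σ ∘ dbl)) ∈ E ∧ accA K (σ (2 * (i + 1) + 1)) ∈ E := by
  have h : ∀ f : ℕ → List (Atom Var), Holds σ ((List.range ρ.head.length).flatMap f) E ↔
      ∀ i < ρ.head.length, Holds σ (f i) E := by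
    intro f
    simp only [Holds, List.mem_flatMap, List.mem_range, forall_exists_index, and_imp]
    exact ⟨fun h i hi a ha => h a i hi ha, fun h a i hi ha => h i hi a ha⟩
  simp [acceptRule, exRule, h]

theorem acceptRule_headHolds {ρ : Rule} :
    (acceptRule P K ρ).HeadHolds σ E ↔ accA K (σ 1) ∈ E := by
  rw [acceptRule, exRule_headHolds_of_subset]
  · simp
  · intro x; simp; tauto

theorem simRule_body {ρ : Rule} : Holds σ (simRule P K ρ).body E ↔
    doneA K (σ 1) ∈ E ∧ Holds (σ ∘ dbl) ρ.body (view P K 1 (σ 1) E) := by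
  simp [simRule]

theorem eqOn_simRule_body {ρ : Rule} {σ' : Var → Null}
    (h : Set.EqOn σ' σ (varsOf (simRule P K ρ).body)) :
    σ' 1 = σ 1 ∧ Set.EqOn (σ' ∘ dbl) (σ ∘ dbl) (varsOf ρ.body) :=
  ⟨h (by simp [simRule]), fun _ hx => h (by simp [simRule, dbl_mem_varsOf_conjInWorld hx])⟩

theorem simRule_headHolds {ρ : Rule} : (simRule P K ρ).HeadHolds σ E ↔
    ρ.HeadHolds (σ ∘ dbl) (view P K 1 (σ 1) E) := by
  constructor
  · rintro ⟨η, hη, σ', he, hh⟩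
    obtain ⟨η, hη', rfl⟩ := List.mem_map.1 hη
    obtain ⟨h1, h2⟩ := eqOn_simRule_body he
    rw [holds_conjInWorld, h1] at hh
    exact ⟨η, hη', _, h2, hh⟩
  · rintro ⟨η, hη, σ', he, hh⟩
    refine ⟨_, List.mem_map_of_mem hη, glue σ' (fun n => σ (2 * n + 1)), ?_, ?_⟩
    · intro y hy
      simp only [simRule, mem_varsOf_cons, newAtom_toList, List.mem_singleton] at hy
      have hy' : y = 1 ∨ ∃ x ∈ varsOf ρ.body, y = dbl x := by
        rcases hy with hy | hy
        · exact Or.inl hy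
        · exact mem_varsOf_conjInWorld hy
      rcases hy' with rfl | ⟨x, hx, rfl⟩
      · simp
      · simpa using he hx
    · simpa using hh

end Rules

/-! ### Soundness: the model with two worlds -/

theorem newAtom_pred_notMem {T : Type} {P : Set Predicate} {K : ℕ} (hK : ∀ p ∈ P, p.name < K)
    (i j : ℕ) (l : List T) : (newAtom K i j l).pred ∉ P := fun h =>
  absurd (hK _ h) (Nat.not_lt.2 (le_newAtom_name K i j l))

theorem Rule.disj_vars {ρ : Rule} (hρ : ρ.IsDisjunctiveDatalog) {i : ℕ}
    (hi : i < ρ.head.length) : varsOf (ρ.disj i) ⊆ varsOf ρ.body := by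
  rw [Rule.disj_eq hi]
  exact hρ _ (List.getElem_mem hi)

theorem Rule.headHolds_datalog {ρ : Rule} (hρ : ρ.IsDisjunctiveDatalog) {σ : Var → Null}
    {I : Interpretation} (h : ρ.HeadHolds σ I) : ∃ i < ρ.head.length, Holds σ (ρ.disj i) I := by
  obtain ⟨η, hη, σ', he, hh⟩ := h
  obtain ⟨i, hi, rfl⟩ := List.getElem_of_mem hη
  refine ⟨i, hi, ?_⟩
  rw [Rule.disj_eq hi]
  exact hh.congr (he.mono (hρ _ hη)).symm

/-- The disjunct with code `c`, instantiated with `x`, holds in `I`. -/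
def DisjHolds (I : Interpretation) (c : ℕ) (x : List Null) : Prop :=
  ∃ (ρ : Rule) (i : ℕ) (σ : Var → Null),
    c = ρ.disjCode i ∧ x = ρ.bodyVars.map σ ∧ Holds σ (ρ.disj i) I

/-- The code determines the rule and the disjunct, and the arguments determine the substitution on
the body variables; a Datalog disjunct has no other variables. -/
theorem disjHolds_iff {I : Interpretation} {ρ : Rule} (hρ : ρ.IsDisjunctiveDatalog) {i : ℕ}
    (hi : i < ρ.head.length) {σ : Var → Null} :
    DisjHolds I (ρ.disjCode i) (ρ.bodyVars.map σ) ↔ Holds σ (ρ.disj i) I := by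
  constructor
  · rintro ⟨τ, j, υ, hc, hx, hh⟩
    obtain ⟨rfl, rfl⟩ := Rule.disjCode_inj hc
    exact hh.congr ((Rule.eqOn_of_map_bodyVars hx).mono (Rule.disj_vars hρ hi))
  · exact fun h => ⟨ρ, i, σ, rfl, rfl, h⟩

/-- The facts of the model with two worlds, the good world `0` with the facts of `I`, and the
bad world `1` with all facts. -/
def TwoWorldFact (P : Set Predicate) (I : Interpretation) (i j : ℕ) (l : List Null) : Prop :=
  match i with
  | 0 | 1 => (∃ x, l = 1 :: x) ∨ ∃ b ∈ I, b.pred ∉ P ∧ j = b.pred.name ∧ l = 0 :: b.toList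
  | 2 => (∃ x, l = 0 :: 0 :: x ∧ DisjHolds I j x) ∨ (∃ x, l = 0 :: 1 :: x ∧ ¬ DisjHolds I j x) ∨
      ∃ x, l = 1 :: 1 :: x
  | 3 => l = [0, 0] ∨ l = [0, 1] ∨ l = [1, 1]
  | 4 => l = [0] ∨ l = [1]
  | 5 => l = [0]
  | _ => l = [1]

/-- The model with two worlds. -/
def twoWorldModel (P : Set Predicate) (K : ℕ) (I : Interpretation) : Interpretation :=
  {a | (a.pred ∈ P ∧ a ∈ I) ∨ ∃ i j l, a = newAtom K i j l ∧ TwoWorldFact P I i j l}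

section

variable {P : Set Predicate} {K : ℕ} {I : Interpretation}

theorem newAtom_mem_twoWorldModel (hK : ∀ p ∈ P, p.name < K) {i j : ℕ} {l : List Null} :
    newAtom K i j l ∈ twoWorldModel P K I ↔ TwoWorldFact P I i j l := by
  constructor
  · rintro (⟨h, -⟩ | ⟨i', j', l', he, h⟩)
    · exact absurd h (newAtom_pred_notMem hK i j l)
    · obtain ⟨rfl, rfl, rfl⟩ := newAtom_inj.1 he
      exact h
  · exact fun h => Or.inr ⟨i, j, l, rfl, h⟩

theorem mem_twoWorldModel_of_name_lt {a : Atom Null} (ha : a.pred.name < K) :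
    a ∈ twoWorldModel P K I ↔ a.pred ∈ P ∧ a ∈ I := by
  constructor
  · rintro (h | ⟨i', j', l', rfl, -⟩)
    · exact h
    · exact absurd ha (Nat.not_lt.2 (le_newAtom_name _ _ _ _))
  · exact Or.inl

theorem twoWorldFact_le_one {l j : ℕ} (hl : l = 0 ∨ l = 1) {x : List Null} :
    TwoWorldFact P I l j x ↔
      (∃ y, x = 1 :: y) ∨ ∃ b ∈ I, b.pred ∉ P ∧ j = b.pred.name ∧ x = 0 :: b.toList := by
  rcases hl with rfl | rfl <;> exact Iff.rfl

theorem view_good_world (hK : ∀ p ∈ P, p.name < K) {l : ℕ} (hl : l = 0 ∨ l = 1) :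
    view P K l 0 (twoWorldModel P K I) = I := by
  ext a
  rw [mem_view]
  by_cases hp : a.pred ∈ P
  · rw [Atom.inWorld_of_mem hp, mem_twoWorldModel_of_name_lt (hK _ hp)]
    simp [hp]
  · rw [Atom.inWorld_of_notMem hp, newAtom_mem_twoWorldModel hK, twoWorldFact_le_one hl]
    constructor
    · rintro (⟨x, h⟩ | ⟨b, hb, hbp, hn, h⟩)
      · simp at h
      · rwa [Atom.ext_list hn (by simpa using h)]
    · exact fun ha => Or.inr ⟨a, ha, hp, rfl, rfl⟩

theorem mem_view_bad_world (hK : ∀ p ∈ P, p.name < K) {l : ℕ} (hl : l = 0 ∨ l = 1) {a : Atom Null}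
    (ha : a.pred ∉ P) : a ∈ view P K l 1 (twoWorldModel P K I) := by
  rw [mem_view, Atom.inWorld_of_notMem ha, newAtom_mem_twoWorldModel hK, twoWorldFact_le_one hl]
  exact Or.inl ⟨_, rfl⟩

theorem holds_bad_world (hK : ∀ p ∈ P, p.name < K) {l : ℕ} (hl : l = 0 ∨ l = 1)
    {c : List (Atom Var)} (hc : ∀ a ∈ c, a.pred ∉ P) (σ : Var → Null) :
    Holds σ c (view P K l 1 (twoWorldModel P K I)) :=
  fun a ha => mem_view_bad_world hK hl (hc a ha)

/-- In the good world the rules hold because they hold in `I`. In the bad world all heads hold,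
because head predicates are not in `P` and all facts over other predicates are present. -/
theorem twoWorldModel_isModel (hK : ∀ p ∈ P, p.name < K) {goal : Predicate}
    {S₁ S₂ : Set Rule} (h₁ : ∀ ρ ∈ S₁, ρ.IsDisjunctiveDatalog)
    (hP : ∀ p ∈ P, p ∉ headPredicates (S₁ ∪ S₂)) (hI : IsModelOfRules I (S₁ ∪ S₂))
    (hgoal : mkAtom goal.name [] ∉ I) :
    IsModelOfRules (twoWorldModel P K I) (worldRules P K goal S₁ S₂) := by
  have hhead : ∀ ρ ∈ S₁ ∪ S₂, ∀ η ∈ ρ.head, ∀ a ∈ η, a.pred ∉ P :=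
    fun ρ hρ η hη a ha hp => hP _ hp ⟨ρ, hρ, η, hη, a, ha, rfl⟩
  intro ρ hρ σ hb
  rcases mem_worldRules.1 hρ with rfl | rfl | rfl | rfl | ⟨τ, hτ, rfl⟩ | ⟨τ, hτ, i, hi, rfl⟩ |
    ⟨τ, hτ, i, hi, rfl⟩ | ⟨τ, hτ, rfl⟩
  · rw [rootRule_headHolds]
    refine ⟨0, ?_⟩
    simp [newAtom_mem_twoWorldModel hK, TwoWorldFact]
  · rw [doneRule_body] at hb
    rw [doneRule_headHolds]
    simp only [newAtom_mem_twoWorldModel hK, TwoWorldFact] at hb ⊢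
    simp at hb ⊢
    tauto
  · rw [goalRule_body] at hb
    rw [goalRule_headHolds]
    simp only [newAtom_mem_twoWorldModel hK, TwoWorldFact] at hb ⊢
    rcases hb with ⟨x, hx⟩ | ⟨b, hb, -, hn, hx⟩
    · simp at hx ⊢; exact hx.1
    · simp at hx
      refine absurd ?_ hgoal
      rwa [Atom.ext_list (a := mkAtom goal.name []) (b := b) hn (by simpa using hx.2.symm)]
  · rw [finalRule_body] at hb
    simp only [newAtom_mem_twoWorldModel hK, TwoWorldFact] at hb
    simp at hb
    exact absurd (hb.1.symm.trans hb.2) (by decide)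
  · rw [acceptRule_body] at hb
    rw [acceptRule_headHolds]
    obtain ⟨hd, hb, hi⟩ := hb
    simp only [newAtom_mem_twoWorldModel hK, TwoWorldFact] at hd hi ⊢
    simp only [List.cons.injEq, and_true] at hd ⊢
    rcases hd with hd | hd
    · rw [hd, view_good_world hK (Or.inl rfl)] at hb
      -- Some disjunct holds in `I`, so its only successor of the good world is the good world,
      -- which is not accepted.
      obtain ⟨i, hil, hh⟩ := Rule.headHolds_datalog (h₁ τ hτ) (hI τ (Or.inl hτ) _ hb)
      have hT := (disjHolds_iff (h₁ τ hτ) hil).2 hh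
      obtain ⟨hi1, hi2⟩ := hi i hil
      simp [hd, hT] at hi1
      have hi3 : σ (2 * (i + 1) + 1) = 1 := by simpa using hi2
      exact absurd (hi1.symm.trans hi3) (by decide)
    · exact hd
  · rw [branchRule_body] at hb
    rw [branchRule_headHolds]
    obtain ⟨hd, hb⟩ := hb
    simp only [newAtom_mem_twoWorldModel hK, TwoWorldFact] at hd ⊢
    simp only [List.cons.injEq, and_true] at hd ⊢
    -- The good world leads to itself for instances that hold in `I`, and to the bad world for all
    -- others.
    by_cases hT : DisjHolds I (τ.disjCode i) (τ.bodyVars.map (σ ∘ dbl))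
    · rcases hd with hd | hd
      · exact ⟨0, by simp [hd, hT]⟩
      · exact ⟨1, by simp [hd]⟩
    · rcases hd with hd | hd
      · exact ⟨1, by simp [hd, hT]⟩
      · exact ⟨1, by simp [hd]⟩
  · rw [inheritRule_body] at hb
    rw [inheritRule_headHolds (h₁ τ hτ) hi]
    have hη : ∀ a ∈ τ.disj i, a.pred ∉ P := by
      rw [Rule.disj_eq hi]
      exact hhead τ (Or.inl hτ) _ (List.getElem_mem hi)
    simp only [newAtom_mem_twoWorldModel hK, TwoWorldFact] at hb ⊢
    simp only [List.cons.injEq, and_true] at hb ⊢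
    obtain ⟨hb1, hb2⟩ := hb
    rcases hb2 with ⟨h3, h5⟩ | ⟨h3, h5⟩ | ⟨h3, h5⟩
    · simp only [h3] at hb1
      have : σ 1 = 0 ∧ DisjHolds I (τ.disjCode i) (τ.bodyVars.map (σ ∘ dbl)) := by
        simpa using hb1
      rw [h5, view_good_world hK (Or.inl rfl), view_good_world hK (Or.inr rfl),
        ← disjHolds_iff (h₁ τ hτ) hi]
      simp [this.1, this.2]
    all_goals
      have : σ 1 = 0 ∨ σ 1 = 1 := by
        rcases hb1 with ⟨x, hx, -⟩ | ⟨x, hx, -⟩ | ⟨x, hx⟩ <;> tauto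
      rw [h5]
      refine ⟨by simp, ?_, holds_bad_world hK (Or.inl rfl) hη _,
        holds_bad_world hK (Or.inr rfl) hη _⟩
      simpa using this
  · rw [simRule_body] at hb
    rw [simRule_headHolds]
    obtain ⟨hd, hb⟩ := hb
    simp only [newAtom_mem_twoWorldModel hK, TwoWorldFact] at hd
    simp only [List.cons.injEq, and_true] at hd
    rcases hd with hd | hd
    · rw [hd, view_good_world hK (Or.inr rfl)] at hb ⊢
      exact hI τ (Or.inr hτ) _ hb
    · rw [hd]
      obtain ⟨η, hη⟩ := List.exists_mem_of_ne_nil _ τ.head_ne_nil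
      exact ⟨η, hη, _, fun _ _ => rfl,
        holds_bad_world hK (Or.inr rfl) (hhead τ (Or.inr hτ) η hη) _⟩

end

theorem nullaryFact_eq (p : Predicate) (hp : p.arity = 0) :
    nullaryFact p hp = {mkAtom p.name []} := by
  rw [nullaryFact]
  congr 1
  refine Atom.ext_list rfl ?_
  apply List.eq_nil_of_length_eq_zero
  rw [Atom.length_toList, hp]

theorem isModelOf_nullaryFact {p : Predicate} {hp : p.arity = 0} {I : Interpretation} :
    IsModelOf I (nullaryFact p hp) ↔ mkAtom p.name [] ∈ I := by
  simp [nullaryFact_eq, IsModelOf, IsHom, mkAtom_map]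

/-- In the two-world model, facts with names below `K` are facts of `I`, so a model `I` without the
goal gives a countermodel for the new rules. -/
theorem entails_of_entails_worldRules {P : Set Predicate} {K : ℕ} (hK : ∀ p ∈ P, p.name < K)
    {goal : Predicate} (hgoal : goal.arity = 0) (hgK : goal.name < K)
    {S₁ S₂ : Set Rule} (h₁ : ∀ ρ ∈ S₁, ρ.IsDisjunctiveDatalog)
    (hP : ∀ p ∈ P, p ∉ headPredicates (S₁ ∪ S₂)) {D : Interpretation} (hD : IsOver P D)
    (h : Entails (worldRules P K goal S₁ S₂) D (nullaryFact goal hgoal)) :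
    Entails (S₁ ∪ S₂) D (nullaryFact goal hgoal) := by
  intro I hI hDI
  obtain ⟨f, hf⟩ := hDI
  rw [isModelOf_nullaryFact]
  by_contra hg
  have := h _ (twoWorldModel_isModel hK h₁ hP hI hg)
    ⟨f, fun a ha => Or.inl ⟨hD a ha, hf a ha⟩⟩
  rw [isModelOf_nullaryFact, mem_twoWorldModel_of_name_lt (by simpa using hgK)] at this
  exact hg this.2

/-! ### Completeness: following unaccepted worlds to a leaf -/

section

variable {P : Set Predicate} {K : ℕ}

/-- `F` is contained in both layers of all worlds of `J` that contain `w`, and these worlds are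
complete. -/
def Carries (P : Set Predicate) (K : ℕ) (J : Interpretation) (w : Null) (F : Interpretation) :
    Prop :=
  subsA K w w ∈ J ∧ ∀ w', subsA K w w' ∈ J →
    doneA K w' ∈ J ∧ F ⊆ view P K 0 w' J ∧ F ⊆ view P K 1 w' J

/-- Datalog steps introduce no nulls, and each step adds an atom. Together these bound the depth by
the number of atoms over the nulls of `D`. -/
theorem chase_label_subset {S : Set Rule} {D : Interpretation} {T : LabelledTree}
    (hT : IsChaseTree S D T) (hS : ∀ ρ ∈ S, ρ.IsDisjunctiveDatalog) : ∀ v ∈ T.nodes,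
    (∀ a ∈ T.label v, a.pred ∈ headPredicates S ∪ Atom.pred '' D ∧ ∀ t ∈ a.toList, t ∈ nullsOf D)
      ∧ ∃ F : Finset (Atom Null), v.length ≤ F.card ∧ (F : Set (Atom Null)) ⊆ T.label v := by
  intro v
  induction v with
  | nil =>
    intro _
    refine ⟨fun a ha => ?_, ∅, by simp⟩
    rw [hT.1] at ha
    exact ⟨Or.inr ⟨a, ha, rfl⟩, fun t ht => mem_nullsOf.2 ⟨a, ha, ht⟩⟩
  | cons i v ih =>
    intro hv
    obtain ⟨ih1, F, hF, hFv⟩ := ih (T.parent_mem i v hv)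
    obtain ⟨ρ, hρ, σ, happ, hc, hl⟩ := hT.2.1 v (T.parent_mem i v hv) ⟨i, hv⟩
    have hi := (hc i).1 hv
    obtain ⟨τ, ⟨hτ, -, -⟩, he⟩ := hl i hi
    have hsub := hS ρ hρ _ (List.getElem_mem hi)
    constructor
    · rw [he]
      rintro b (hb | ⟨a, ha, rfl⟩)
      · exact ih1 b hb
      · refine ⟨Or.inl ⟨ρ, hρ, _, List.getElem_mem hi, a, ha, rfl⟩, fun t ht => ?_⟩
        obtain ⟨x, hx, rfl⟩ := by simpa using ht
        have hxb := hsub (mem_varsOf.2 ⟨a, ha, hx⟩)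
        obtain ⟨b, hb, hxb'⟩ := mem_varsOf.1 hxb
        refine (ih1 _ (happ.1 b hb)).2 _ ?_
        rw [hτ hxb]
        simpa using ⟨x, hxb', rfl⟩
    · have hnew : ¬ Holds τ ρ.head[i] (T.label v) := fun h =>
        happ.2 ⟨_, List.getElem_mem hi, τ, hτ, h⟩
      simp only [Holds, not_forall] at hnew
      obtain ⟨a, ha, hav⟩ := hnew
      classical
      refine ⟨insert (a.map τ) F, ?_, ?_⟩
      · rw [Finset.card_insert_of_notMem fun h => hav (hFv h)]
        simpa using hF
      · rw [he]
        intro b hb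
        rcases Finset.mem_insert.1 hb with rfl | hb
        · exact Or.inr ⟨a, ha, rfl⟩
        · exact Or.inl (hFv hb)

/-- Chase trees for disjunctive Datalog rules have bounded depth. -/
theorem exists_depth_bound {S : Set Rule} (hfin : S.Finite) {D : Interpretation} (hD : D.Finite)
    {T : LabelledTree} (hT : IsChaseTree S D T) (hS : ∀ ρ ∈ S, ρ.IsDisjunctiveDatalog) :
    ∃ n, ∀ v ∈ T.nodes, v.length ≤ n := by
  have hA := finite_atoms ((headPredicates_finite hfin).union (hD.image Atom.pred))
    (nullsOf_finite hD)
  refine ⟨hA.toFinset.card, fun v hv => ?_⟩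
  obtain ⟨h1, F, hF, hFv⟩ := chase_label_subset hT hS v hv
  refine hF.trans (Finset.card_le_card fun a ha => ?_)
  rw [Set.Finite.mem_toFinset]
  exact h1 a (hFv ha)

/-- A node of the chase tree of `S₁` is matched with an unaccepted world of `J` that carries its
label. A world without acceptance has, for the rule applied at the node, a successor without
acceptance, so the path continues to a leaf, where the split applies. -/
theorem entails_worldRules {S₁ S₂ : Set Rule} {D : Interpretation} (hD : D.Finite)
    (hPD : IsOver P D) (hfin : S₁.Finite)
    (h₁ : ∀ ρ ∈ S₁, ρ.IsDisjunctiveDatalog) (h₂ : ∀ ρ ∈ S₂, ρ.IsExistential)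
    (hsplit : ∀ M : Set Interpretation, IsChaseResult (S₁ ∪ S₂) D M →
        ∃ M₁ : Set Interpretation, IsChaseResult S₁ D M₁ ∧
          ∃ C : Interpretation → Interpretation,
            (∀ I ∈ M₁, IsChaseResult S₂ I {C I}) ∧ M = C '' M₁)
    {goal : Predicate} (hgoal : goal.arity = 0) (hgP : goal ∉ P)
    (h : Entails (S₁ ∪ S₂) D (nullaryFact goal hgoal)) :
    Entails (worldRules P K goal S₁ S₂) D (nullaryFact goal hgoal) := by
  intro J hJ ⟨f, hf⟩
  rw [isModelOf_nullaryFact]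
  by_contra hg
  have hrule := fun ρ hρ => hJ ρ (mem_worldRules.2 hρ)
  obtain ⟨T, hT⟩ := exists_isChaseTree (S₁ ∪ S₂) hD
  obtain ⟨M₁, ⟨T₁, hT₁, rfl⟩, C, hC, hM⟩ := hsplit _ ⟨T, hT, rfl⟩
  obtain ⟨n, hn⟩ := exists_depth_bound hfin hD hT₁ h₁
  -- a world that is not accepted for nodes of every depth, unless there is a leaf
  have key : ∀ m, (∃ v ∈ T₁.nodes, (∀ i, i :: v ∉ T₁.nodes) ∧ ∃ w, accA K w ∉ J ∧
      Carries P K J w {a | ∃ b ∈ T₁.label v, a = b.map f}) ∨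
      ∃ v ∈ T₁.nodes, v.length = m ∧ ∃ w, accA K w ∉ J ∧
      Carries P K J w {a | ∃ b ∈ T₁.label v, a = b.map f} := by
    intro m
    induction m with
    | zero =>
      refine Or.inr ⟨[], T₁.root_mem, rfl, ?_⟩
      obtain ⟨w, hw1, hw2⟩ := rootRule_headHolds.1
        (hrule (rootRule K) (by simp) (fun _ => 0) (by simp [rootRule, exRule]))
      refine ⟨w, fun hacc => hg ?_, hw2, fun w' hw' => ?_⟩
      · have := finalRule_headHolds.1 (hrule (finalRule K goal) (by simp) (fun _ => w)
          (finalRule_body.2 ⟨hw1, hacc⟩))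
        exact this
      · have hd := doneRule_headHolds.1 (hrule (doneRule K) (by simp)
          (glue (fun _ => 0) (fun j => if j = 0 then w else w'))
          (doneRule_body.2 (by simpa using ⟨hw1, hw'⟩)))
        refine ⟨by simpa using hd, ?_, ?_⟩
        all_goals
          rintro _ ⟨b, hb, rfl⟩
          rw [hT₁.1] at hb
          rw [mem_view, Atom.inWorld_of_mem (by simpa using hPD b hb)]
          exact hf b hb
    | succ m ih =>
      rcases ih with ih | ⟨v, hv, hvm, w, hacc, hw⟩
      · exact Or.inl ih
      by_cases hleaf : ∀ i, i :: v ∉ T₁.nodes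
      · exact Or.inl ⟨v, hv, hleaf, w, hacc, hw⟩
      push Not at hleaf
      obtain ⟨ρ, hρ, σ, happ, hc, hl⟩ := hT₁.2.1 v hv hleaf
      have hdw := hw.2 w hw.1
      have hbody : Holds (fun x => f (σ x)) ρ.body (view P K 0 w J) := fun a ha =>
        hdw.2.1 ⟨a.map σ, happ.1 a ha, rfl⟩
      have hbranch : ∀ i < ρ.head.length, ∃ w', insA K (ρ.disjCode i) w w'
          (ρ.bodyVars.map (fun x => f (σ x))) ∈ J ∧ subsA K w' w' ∈ J := by
        intro i hi
        have := branchRule_headHolds.1 (hrule (branchRule P K ρ i)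
          (Or.inr (Or.inr (Or.inr (Or.inr (Or.inr (Or.inl ⟨ρ, hρ, i, hi, rfl⟩))))))
          (glue (fun x => f (σ x)) (fun _ => w))
          (branchRule_body.2 (by simpa using ⟨hdw.1, hbody⟩)))
        simpa using this
      choose! g hg1 hg2 using hbranch
      have : ∃ i < ρ.head.length, accA K (g i) ∉ J := by
        by_contra! hall
        have := acceptRule_headHolds.1 (hrule (acceptRule P K ρ)
          (Or.inr (Or.inr (Or.inr (Or.inr (Or.inl ⟨ρ, hρ, rfl⟩)))))
          -- Index `0` is the parent world and index `i + 1` the successor for disjunct `i`, in line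
          -- with the variable `2 * (i + 1) + 1` in `acceptRule`.
          (glue (fun x => f (σ x)) (fun j => if j = 0 then w else g (j - 1)))
          (acceptRule_body.2 (by
            refine ⟨by simpa using hdw.1, by simpa using hbody, fun i hi => ?_⟩
            rw [glue_odd]
            simpa using ⟨hg1 i hi, hall i hi⟩)))
        exact hacc (by simpa using this)
      obtain ⟨i, hi, hgi⟩ := this
      obtain ⟨τ, ⟨hτ, -, -⟩, he⟩ := hl i hi
      refine Or.inr ⟨i :: v, (hc i).2 hi, by simp [hvm], g i, hgi, hg2 i hi, fun w' hw' => ?_⟩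
      have hinh := (inheritRule_headHolds (h₁ ρ hρ) hi).1 (hrule (inheritRule P K ρ i)
          (Or.inr (Or.inr (Or.inr (Or.inr (Or.inr (Or.inr (Or.inl ⟨ρ, hρ, i, hi, rfl⟩)))))))
          (glue (fun x => f (σ x)) (fun j => if j = 0 then w else if j = 1 then g i else w'))
          (inheritRule_body.2 (by simpa using ⟨hg1 i hi, hw'⟩)))
      simp only [glue_one, glue_five, if_true, glue_comp_dbl] at hinh
      obtain ⟨-, hs, h0, h1⟩ := hinh
      -- Inheritance makes `w'` contain the parent world `w`; this is why `Carries` speaks of all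
      -- worlds that contain the given one.
      obtain ⟨hd, hF0, hF1⟩ := hw.2 w' hs
      have hmap : ∀ a ∈ ρ.head[i], (a.map τ).map f = a.map (fun x => f (σ x)) := by
        intro a ha
        rw [Atom.map_map]
        refine Atom.map_congr fun t ht => ?_
        rw [hτ (h₁ ρ hρ _ (List.getElem_mem hi) (mem_varsOf.2 ⟨a, ha, ht⟩))]
      rw [Rule.disj_eq hi] at h0 h1
      refine ⟨hd, ?_, ?_⟩
      all_goals
        rintro _ ⟨b, hb, rfl⟩
        rw [he] at hb
        rcases hb with hb | ⟨a, ha, rfl⟩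
        · first
          | exact hF0 ⟨b, hb, rfl⟩
          | exact hF1 ⟨b, hb, rfl⟩
        · rw [hmap a ha]
          first
          | exact h0 a ha
          | exact h1 a ha
  -- No node has depth `n + 1`, so a leaf has been reached.
  rcases key (n + 1) with ⟨v, hv, hleaf, w, hacc, hw⟩ | ⟨v, hv, hl, -⟩
  swap
  · exact absurd (hn v hv) (by omega)
  have hvres := hT₁.label_mem_result hv hleaf
  -- By the split, the result of the `S₂`-chase from the leaf belongs to a chase result for all
  -- rules; it is a model of them and of `D`, so it contains the goal.
  have hCM : C (T₁.label v) ∈ T.result := hM ▸ ⟨_, hvres, rfl⟩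
  have hgC : mkAtom goal.name [] ∈ C (T₁.label v) := by
    rw [← isModelOf_nullaryFact (hp := hgoal)]
    exact h _ (hT.isModelOfRules hCM) ⟨id, fun a ha => hT.subset_of_mem_result hCM ha⟩
  obtain ⟨T₂, hT₂, hC₂⟩ := hC _ hvres
  have : C (T₁.label v) ∈ T₂.result := hC₂ ▸ rfl
  obtain ⟨Q, hQ, hCQ⟩ := this
  rw [hCQ] at hgC
  obtain ⟨u, hu, hgu⟩ : ∃ u ∈ Q, mkAtom goal.name [] ∈ T₂.label u := by simpa using hgC
  have hdw := hw.2 w hw.1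
  have hmodel : IsModelOfRules (view P K 1 w J) S₂ := by
    intro ρ hρ σ hb
    have := simRule_headHolds.1 (hrule (simRule P K ρ)
      (Or.inr (Or.inr (Or.inr (Or.inr (Or.inr (Or.inr (Or.inr ⟨ρ, hρ, rfl⟩)))))))
      (glue σ (fun _ => w)) (simRule_body.2 (by simpa using ⟨hdw.1, hb⟩)))
    simpa using this
  obtain ⟨f', hf'⟩ := hT₂.exists_isHom_label h₂ hmodel
    (h := f) (fun a ha => hdw.2.2 ⟨a, ha, rfl⟩) u (hQ.2.1 hu)
  have hgv := hf' _ hgu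
  have hgoal' : (mkAtom goal.name ([] : List Null)).pred = goal := by
    obtain ⟨m, k⟩ := goal
    simp only at hgoal
    subst hgoal
    rfl
  rw [mkAtom_map, List.map_nil, mem_view, Atom.inWorld_of_notMem (by rw [hgoal']; exact hgP)] at hgv
  refine hacc ?_
  have := goalRule_headHolds.1 (hrule (goalRule K goal) (by simp) (fun _ => w)
    (goalRule_body.2 (by simpa using hgv)))
  exact this

end

/-! ### Chase steps and infinite step sequences -/

/-- `E'` results from `E` by a chase step with `⟨ρ, σ⟩`, for a chosen disjunct of the head. -/
def Rule.Step (ρ : Rule) (σ : Var → Null) (E E' : Interpretation) : Prop :=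
  ρ.Applicable σ E ∧ ∃ η ∈ ρ.head, ∃ τ, ρ.IsFreshExtension η E σ τ ∧
    E' = E ∪ {b | ∃ a ∈ η, b = a.map τ}

theorem Rule.Step.subset {ρ : Rule} {σ : Var → Null} {E E' : Interpretation}
    (h : ρ.Step σ E E') : E ⊆ E' := by
  obtain ⟨-, η, -, τ, -, rfl⟩ := h
  exact Set.subset_union_left

theorem Rule.Step.finite {ρ : Rule} {σ : Var → Null} {E E' : Interpretation}
    (h : ρ.Step σ E E') (hE : E.Finite) : E'.Finite := by
  obtain ⟨-, η, -, τ, -, rfl⟩ := h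
  exact hE.union (finite_instance _ _)

theorem Rule.Step.headHolds {ρ : Rule} {σ : Var → Null} {E E' : Interpretation}
    (h : ρ.Step σ E E') : ρ.HeadHolds σ E' := by
  obtain ⟨-, η, hη, τ, hτ, rfl⟩ := h
  exact ⟨η, hη, τ, hτ.1, fun a ha => Or.inr ⟨a, ha, rfl⟩⟩

theorem Rule.Step.exists_new {ρ : Rule} {σ : Var → Null} {E E' : Interpretation}
    (h : ρ.Step σ E E') : ∃ a ∈ E', a ∉ E := by
  by_contra! hcon
  exact h.1.2 (h.headHolds.mono hcon)

/-- An infinite chase tree for existential rules is an infinite sequence of steps. -/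
theorem exists_step_sequence {S : Set Rule} (hS : ∀ ρ ∈ S, ρ.IsExistential) {D : Interpretation}
    {T : LabelledTree} (hT : IsChaseTree S D T) (hinf : ¬ T.nodes.Finite) :
    ∃ E : ℕ → Interpretation, E 0 = D ∧ (∀ n, ∃ ρ ∈ S, ∃ σ, ρ.Step σ (E n) (E (n + 1))) ∧
      ∀ ρ ∈ S, ∀ σ, ∃ m, ∀ n, m ≤ n → ¬ ρ.Applicable σ (E n) := by
  -- Heads have a single disjunct, so every child has index `0` and the tree is a path.
  have h0 : ∀ v ∈ T.nodes, v = List.replicate v.length 0 := by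
    intro v
    induction v with
    | nil => intro _; rfl
    | cons i v ih =>
      intro hv
      obtain ⟨ρ, hρ, σ, -, hc, -⟩ := hT.2.1 v (T.parent_mem i v hv) ⟨i, hv⟩
      have h1 := (hc i).1 hv
      have h2 : ρ.head.length = 1 := hS ρ hρ
      have h3 : i = 0 := by omega
      rw [h3, List.length_cons, List.replicate_succ, ← ih (T.parent_mem i v hv)]
  have hall : ∀ n, List.replicate n 0 ∈ T.nodes := by
    intro n
    by_contra hn
    refine hinf (((Set.finite_Iio n).image fun m => List.replicate m 0).subset ?_)
    intro v hv
    refine ⟨v.length, ?_, (h0 v hv).symm⟩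
    by_contra hle
    have hle : n ≤ v.length := not_lt.1 hle
    refine hn (T.mem_of_append (l := List.replicate (v.length - n) 0) ?_)
    rw [← List.replicate_add, Nat.sub_add_cancel hle, ← h0 v hv]
    exact hv
  have hbr : T.IsBranch T.nodes := by
    refine ⟨T.root_mem, subset_rfl, T.parent_mem, ?_, fun v _ h => h⟩
    intro i j v hi hj
    have h1 := h0 _ hi
    have h2 := h0 _ hj
    simp only [List.length_cons, List.replicate_succ, List.cons.injEq] at h1 h2
    rw [h1.1, h2.1]
  refine ⟨fun n => T.label (List.replicate n 0), hT.1, fun n => ?_, fun ρ hρ σ => ?_⟩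
  · have hn := hall (n + 1)
    rw [List.replicate_succ] at hn
    obtain ⟨ρ, hρ, σ, happ, hc, hl⟩ := hT.2.1 _ (hall n) ⟨0, hn⟩
    have hi := (hc 0).1 hn
    obtain ⟨τ, hτ, he⟩ := hl 0 hi
    exact ⟨ρ, hρ, σ, happ, _, List.getElem_mem hi, τ, hτ, he⟩
  · obtain ⟨v, hv, h⟩ := hT.2.2 _ hbr ρ hρ σ
    exact ⟨v.length, fun n hn => h _ (hall n) (by simpa using hn)⟩

/-- A fair sequence with infinitely many chase steps, apart from repetitions, shows that the
chase does not terminate. -/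
theorem not_chaseTerminating {S : Set Rule} (hS : ∀ ρ ∈ S, ρ.IsExistential)
    {V : ℕ → Interpretation}
    (hstep : ∀ n, V (n + 1) = V n ∨ ∃ ρ ∈ S, ∃ σ, ρ.Step σ (V n) (V (n + 1)))
    (hfair : ∀ ρ ∈ S, ∀ σ, ∃ m, ∀ n, m ≤ n → ¬ ρ.Applicable σ (V n))
    (hinf : {n | V (n + 1) ≠ V n}.Infinite) : ¬ ChaseTerminating S (V 0) := by
  -- `φ` enumerates the positions at which `V` changes; dropping all others leaves a genuine chase.
  set φ := Nat.nth fun n => V (n + 1) ≠ V n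
  have hmono : StrictMono φ := Nat.nth_strictMono hinf
  have hmem : ∀ k, V (φ k + 1) ≠ V (φ k) := fun k => Nat.nth_mem_of_infinite hinf k
  have hconst : ∀ a b, a ≤ b → (∀ n, a ≤ n → n < b → V (n + 1) = V n) → V a = V b := by
    intro a b hab
    induction b, hab using Nat.le_induction with
    | base => intro _; rfl
    | succ b hab ih =>
      intro h
      rw [ih fun n hn hnb => h n hn (by omega), h b hab (by omega)]
  have hran : ∀ n, V (n + 1) ≠ V n → ∃ k, φ k = n := fun n hn => by
    have := Nat.range_nth_of_infinite hinf
    exact (this.symm ▸ hn : n ∈ Set.range φ)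
  have hzero : V 0 = V (φ 0) := by
    refine hconst 0 _ (Nat.zero_le _) fun n _ hn => ?_
    by_contra hne
    obtain ⟨k, rfl⟩ := hran n hne
    exact absurd (hmono.lt_iff_lt.1 hn) (Nat.not_lt_zero k)
  have hsucc : ∀ k, V (φ k + 1) = V (φ (k + 1)) := by
    intro k
    refine hconst _ _ (hmono (Nat.lt_succ_self k)) fun n hn hn' => ?_
    by_contra hne
    obtain ⟨m, rfl⟩ := hran n hne
    have h1 := hmono.lt_iff_lt.1 hn'
    have h2 := hmono.lt_iff_lt.1 hn
    omega
  let T : LabelledTree := ⟨{v | v = List.replicate v.length 0}, rfl, fun i v h => by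
    simp only [Set.mem_ofPred_eq, List.length_cons, List.replicate_succ, List.cons.injEq] at h
    exact h.2, fun v => V (φ v.length)⟩
  have hnode : ∀ i v, v ∈ T.nodes → (i :: v ∈ T.nodes ↔ i = 0) := by
    intro i v hv
    have hv' : v = List.replicate v.length 0 := hv
    constructor
    · intro h
      simp only [T, Set.mem_ofPred_eq, List.length_cons, List.replicate_succ, List.cons.injEq] at h
      exact h.1
    · rintro rfl
      simp only [T, Set.mem_ofPred_eq, List.length_cons, List.replicate_succ, List.cons.injEq]
      exact ⟨trivial, hv'⟩
  intro hterm
  have hrep : ∀ n, List.replicate n 0 ∈ T.nodes := fun n => by simp [T]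
  refine Set.infinite_of_injective_forall_mem (f := fun n => List.replicate n 0) ?_ hrep
    (hterm T ⟨hzero.symm, ?_, ?_⟩)
  · intro m n h
    simpa using congrArg List.length h
  · rintro v hv -
    obtain hs | ⟨ρ, hρ, σ, happ, η, hη, τ, hτ, he⟩ := hstep (φ v.length)
    · exact absurd hs (hmem _)
    have hlen : ρ.head.length = 1 := hS ρ hρ
    refine ⟨ρ, hρ, σ, happ, fun i => ?_, fun i hi => ⟨τ, ?_⟩⟩
    · rw [hnode i v hv]; omega
    · have hη' : ρ.head[i] = η := by
        obtain ⟨j, hj, rfl⟩ := List.getElem_of_mem hη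
        congr 1; omega
      rw [hη']
      refine ⟨hτ, ?_⟩
      rw [← he, hsucc]
      rfl
  · intro Q hQ ρ hρ σ
    have hQall : ∀ n, List.replicate n 0 ∈ Q := by
      intro n
      induction n with
      | zero => exact hQ.1
      | succ n ih =>
        obtain ⟨i, hi⟩ := hQ.2.2.2.2 _ ih ⟨0, (hnode 0 _ (hrep n)).2 rfl⟩
        rwa [(hnode i _ (hrep n)).1 (hQ.2.1 hi)] at hi
    obtain ⟨m, hm⟩ := hfair ρ hρ σ
    refine ⟨_, hQall m, fun u _ hu => hm _ ?_⟩
    rw [List.length_replicate] at hu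
    -- Fairness survives the removal of repetitions because `k ≤ φ k`.
    exact hu.trans (hmono.le_apply)

/-! ### Effect of a single step with each simulating rule -/

section StepLemmas

variable {P : Set Predicate} {K : ℕ} {σ : Var → Null} {E E' : Interpretation}

theorem exRule_step {b : List (Atom Var)} {a : Atom Var} {c : List (Atom Var)}
    (h : (exRule b a c).Step σ E E') : ∃ τ, Set.EqOn τ σ (varsOf b) ∧
      (∀ y ∈ varsOf (a :: c), y ∉ varsOf b → τ y ∉ nullsOf E) ∧
      ∀ d, d ∈ E' ↔ d ∈ E ∨ ∃ e ∈ a :: c, d = e.map τ := by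
  obtain ⟨-, η, hη, τ, ⟨h1, -, h3⟩, rfl⟩ := h
  obtain rfl : η = a :: c := by simpa [exRule] using hη
  exact ⟨τ, h1, fun y hy hyb => h3 y ⟨hy, hyb⟩, fun d => Iff.rfl⟩

theorem exRule_step_of_subset {b : List (Atom Var)} {a : Atom Var} {c : List (Atom Var)}
    (hv : varsOf (a :: c) ⊆ varsOf b) (h : (exRule b a c).Step σ E E') :
      ∀ d, d ∈ E' ↔ d ∈ E ∨ ∃ e ∈ a :: c, d = e.map σ := by
  obtain ⟨τ, h1, -, h3⟩ := exRule_step h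
  intro d
  rw [h3]
  refine or_congr_right (exists_congr fun e => and_congr_right fun he => ?_)
  rw [map_eqOn (h1.mono hv) he]

theorem rootRule_step (h : (rootRule K).Step σ E E') :
    ∃ w, w ∉ nullsOf E ∧ E' = insert (emptyA K w) (insert (subsA K w w) E) := by
  obtain ⟨τ, -, h2, h3⟩ := exRule_step h
  refine ⟨τ 1, h2 1 (by simp) (by simp), ?_⟩
  ext d
  rw [h3]
  simp
  tauto

theorem branchRule_step {ρ : Rule} {i : ℕ} (h : (branchRule P K ρ i).Step σ E E') :
    ∃ w, w ∉ nullsOf E ∧ E' = insert (insA K (ρ.disjCode i) (σ 1) w (ρ.bodyVars.map (σ ∘ dbl)))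
      (insert (subsA K w w) E) := by
  obtain ⟨τ, h1, h2, h3⟩ := exRule_step h
  refine ⟨τ 3, h2 3 (by simp) ?_, ?_⟩
  · simp only [mem_varsOf_cons, newAtom_toList, List.mem_singleton]
    rintro (hy | hy)
    · exact absurd hy (by decide)
    · rcases mem_varsOf_conjInWorld hy with hy | ⟨x, -, hx⟩
      · exact absurd hy (by decide)
      · exact dbl_ne x 1 hx.symm
  · have e1 : τ 1 = σ 1 := h1 (by simp)
    have e2 : ρ.bodyVars.map (τ ∘ dbl) = ρ.bodyVars.map (σ ∘ dbl) :=
      Rule.map_bodyVars fun x hx => h1 (by simp [dbl_mem_varsOf_conjInWorld hx])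
    ext d
    rw [h3]
    simp [e1, e2]
    tauto

theorem inheritRule_step {ρ : Rule} (hρ : ρ.IsDisjunctiveDatalog) {i : ℕ}
    (hi : i < ρ.head.length) (h : (inheritRule P K ρ i).Step σ E E') (d : Atom Null) :
    d ∈ E' ↔ d ∈ E ∨ d = insA K (ρ.disjCode i) (σ 5) (σ 5) (ρ.bodyVars.map (σ ∘ dbl)) ∨
      d = subsA K (σ 1) (σ 5) ∨ ∃ b ∈ ρ.disj i,
        d = (b.map (σ ∘ dbl)).inWorld P K 0 (σ 5) ∨ d = (b.map (σ ∘ dbl)).inWorld P K 1 (σ 5) := by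
  have hv := inheritRule_vars (P := P) (K := K) hρ hi
  simp only [inheritRule, exRule, List.mem_singleton, forall_eq] at hv
  rw [exRule_step_of_subset hv h]
  have e : ∀ l, (∃ e ∈ conjInWorld P K l 5 (ρ.disj i), d = e.map σ) ↔
      ∃ b ∈ ρ.disj i, d = (b.map (σ ∘ dbl)).inWorld P K l (σ 5) := by
    intro l
    simp only [conjInWorld, List.mem_map, exists_exists_and_eq_and, Atom.inWorld_map]
    rfl
  simp only [List.mem_cons, List.mem_append, or_and_right, exists_or, e, exists_eq_left,
    newAtom_map, List.map_cons, List.map_map, List.map_nil, and_or_left]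

theorem doneRule_step (h : (doneRule K).Step σ E E') : E' = insert (doneA K (σ 3)) E := by
  ext d
  rw [exRule_step_of_subset (by intro x; simp; tauto) h]
  simp; tauto

theorem goalRule_step {goal : Predicate} (h : (goalRule K goal).Step σ E E') :
    E' = insert (accA K (σ 1)) E := by
  ext d
  rw [exRule_step_of_subset (by intro x; simp) h]
  simp; tauto

theorem finalRule_step {goal : Predicate} (h : (finalRule K goal).Step σ E E') :
    E' = insert (mkAtom goal.name []) E := by
  ext d
  rw [exRule_step_of_subset (by intro x; simp) h]
  simp [mkAtom_map]; tauto

theorem acceptRule_step {ρ : Rule} (h : (acceptRule P K ρ).Step σ E E') :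
    E' = insert (accA K (σ 1)) E := by
  ext d
  rw [exRule_step_of_subset (by intro x; simp; tauto) h]
  simp; tauto

theorem simRule_step {ρ : Rule} (h : (simRule P K ρ).Step σ E E') :
    ∃ η ∈ ρ.head, ∃ τ, Set.EqOn τ (σ ∘ dbl) (varsOf ρ.body) ∧
      Set.InjOn τ (varsOf η \ varsOf ρ.body) ∧
      (∀ y ∈ varsOf η \ varsOf ρ.body, τ y ∉ nullsOf E) ∧
      E' = E ∪ {b | ∃ a ∈ η, b = (a.map τ).inWorld P K 1 (σ 1)} := by
  obtain ⟨-, η, hη, τ, ⟨h1, h2, h3⟩, rfl⟩ := h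
  obtain ⟨η, hη', rfl⟩ := List.mem_map.1 hη
  obtain ⟨e1, e2⟩ := eqOn_simRule_body h1
  have hv : ∀ y ∈ varsOf η \ varsOf ρ.body, dbl y ∈
      varsOf (conjInWorld P K 1 1 η) \ varsOf (simRule P K ρ).body := by
    rintro y ⟨hy, hyb⟩
    refine ⟨dbl_mem_varsOf_conjInWorld hy, ?_⟩
    simp only [simRule, mem_varsOf_cons, newAtom_toList, List.mem_singleton]
    rintro (h | h)
    · exact dbl_ne y 0 h
    · rcases mem_varsOf_conjInWorld h with h | ⟨x, hx, hxy⟩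
      · exact dbl_ne y 0 h
      · rw [dbl_injective hxy] at hyb
        exact hyb hx
  refine ⟨η, hη', τ ∘ dbl, e2, ?_, fun y hy => h3 _ (hv y hy), ?_⟩
  · intro x hx y hy hxy
    exact dbl_injective (h2 (hv x hx) (hv y hy) hxy)
  · congr 1
    ext d
    simp only [conjInWorld, List.mem_map, exists_exists_and_eq_and, Atom.inWorld_map, e1,
      Set.mem_ofPred_eq]
    rfl

end StepLemmas

/-! ### The invariant and its preservation -/

/-- The instances of disjuncts of rules of `S` with nulls in `N`. -/
def disjUnits (S : Set Rule) (N : Set Null) : Set (ℕ × List Null) :=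
  {u | (∃ ρ ∈ S, ∃ i < ρ.head.length, u.1 = ρ.disjCode i ∧ u.2.length = ρ.bodyVars.length) ∧
    ∀ t ∈ u.2, t ∈ N}

theorem disjUnits_finite {S : Set Rule} (hS : S.Finite) {N : Set Null} (hN : N.Finite) :
    (disjUnits S N).Finite := by
  refine (hS.biUnion fun ρ _ => (Set.finite_Iio ρ.head.length).biUnion fun i _ =>
    (Set.finite_singleton (ρ.disjCode i)).prod (finite_lists hN ρ.bodyVars.length)).subset ?_
  rintro ⟨c, x⟩ ⟨⟨ρ, hρ, i, hi, hc, hx⟩, hN⟩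
  simp only [Set.mem_iUnion]
  exact ⟨ρ, hρ, i, hi, hc, hx, hN⟩

/-- The invariant of the chase with `worldRules`: `L w` lists the instances of disjuncts that
distinguish the world `w` from the root world. -/
structure WorldInv (P : Set Predicate) (K : ℕ) (S₁ : Set Rule) (D E : Interpretation)
    (L : Null → List (ℕ × List Null)) : Prop where
  input : ∀ a ∈ E, a.pred ∈ P → a ∈ D
  empty : ∀ w, emptyA K w ∈ E → subsA K w w ∈ E ∧ L w = []
  inj : ∀ v w, subsA K v v ∈ E → subsA K w w ∈ E → L v = L w → v = w
  units : ∀ w, subsA K w w ∈ E → (L w).Nodup ∧ ∀ u ∈ L w, u ∈ disjUnits S₁ (nullsOf D)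
  ins : ∀ c v w x, insA K c v w x ∈ E → subsA K v v ∈ E ∧ subsA K w w ∈ E ∧
    (L w = (c, x) :: L v ∨ (v = w ∧ (c, x) ∈ L w))
  subs : ∀ v w, subsA K v w ∈ E → subsA K v v ∈ E ∧ subsA K w w ∈ E ∧
    ∃ l, L w = l ++ L v ∧ ∀ u ∈ l, insA K u.1 w w u.2 ∈ E
  done : ∀ w, doneA K w ∈ E → subsA K w w ∈ E ∧ ∀ u ∈ L w, insA K u.1 w w u.2 ∈ E
  of_nil : ∀ w, subsA K w w ∈ E → L w = [] → emptyA K w ∈ E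
  of_cons : ∀ w c x l, subsA K w w ∈ E → L w = (c, x) :: l →
    ∃ v, subsA K v v ∈ E ∧ L v = l ∧ insA K c v w x ∈ E
  layer_zero : ∀ j l, newAtom K 0 j l ∈ E → ∃ w x, l = w :: x ∧ subsA K w w ∈ E ∧
    ∀ t ∈ x, t ∈ nullsOf D
  layer_one : ∀ j l, newAtom K 1 j l ∈ E → ∃ w x, l = w :: x ∧ subsA K w w ∈ E ∧
    (doneA K w ∈ E ∨ ∃ a : Atom Null, a.pred ∈ headPredicates S₁ ∧ j = a.pred.name ∧ x = a.toList)
  disj : ∀ ρ ∈ S₁, ∀ i < ρ.head.length, ∀ σ w,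
    insA K (ρ.disjCode i) w w (ρ.bodyVars.map σ) ∈ E →
      Holds σ (ρ.disj i) (view P K 0 w E) ∧ Holds σ (ρ.disj i) (view P K 1 w E)

/-- The new facts of `E'` only use worlds and nulls of `D`, and do not change layer 1 of worlds
that are complete in `E'`. -/
def ConservativeStep (P : Set Predicate) (K : ℕ) (D E E' : Interpretation) : Prop :=
  (∀ a ∈ E', a ∉ E → ∀ t ∈ a.toList, subsA K t t ∈ E' ∨ t ∈ nullsOf D) ∧
    ∀ w, doneA K w ∈ E' → view P K 1 w E' ⊆ view P K 1 w E

section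

variable {P : Set Predicate} {K : ℕ} {S₁ : Set Rule} {D E E' : Interpretation}
  {L : Null → List (ℕ × List Null)} {σ : Var → Null}

theorem newAtom_fresh {w : Null} (hw : w ∉ nullsOf E) {i j : ℕ} {l : List Null}
    (h : newAtom K i j l ∈ E) : w ∉ l := fun hl =>
  hw (mem_nullsOf.2 ⟨_, h, by simpa using hl⟩)

theorem view_subset_of_new
    (hnew : ∀ a ∈ E', a ∈ E ∨ (a.pred ∉ P ∧ ∀ j l, a ≠ newAtom K 1 j l)) (w : Null) :
    view P K 1 w E' ⊆ view P K 1 w E := by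
  intro a ha
  rw [mem_view] at ha ⊢
  rcases hnew _ ha with h | ⟨h1, h2⟩
  · exact h
  · by_cases hp : a.pred ∈ P
    · rw [Atom.inWorld_of_mem hp] at h1
      exact absurd hp h1
    · rw [Atom.inWorld_of_notMem hp] at h2
      exact absurd rfl (h2 _ _)

namespace WorldInv

/-- A database over `P` contains none of the new predicates, so there are no worlds yet and any `L`
would do. -/
theorem init (hK : ∀ p ∈ P, p.name < K) (hD : IsOver P D) : WorldInv P K S₁ D D fun _ => [] := by
  have h : ∀ {i j l}, newAtom K i j l ∉ D := fun h => newAtom_pred_notMem hK _ _ _ (hD _ h)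
  constructor
  · exact fun a ha _ => ha
  all_goals simp [h]

/-- Facts that do not concern the structure of worlds preserve the invariant. -/
theorem of_irrelevant (h : WorldInv P K S₁ D E L) (hsub : E ⊆ E')
    (hnew : ∀ a ∈ E', a ∈ E ∨ (a.pred ∉ P ∧ ((∃ j w x, a = newAtom K 1 j (w :: x) ∧
      doneA K w ∈ E) ∨ (∃ j l, a = newAtom K 6 j l) ∨ a.pred.name < K))) :
    WorldInv P K S₁ D E' L := by
  have key : ∀ i j l, i ≠ 1 → i ≠ 6 → (newAtom K i j l ∈ E' ↔ newAtom K i j l ∈ E) := by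
    intro i j l h1 h6
    refine ⟨fun ha => ?_, fun ha => hsub ha⟩
    rcases hnew _ ha with h | ⟨-, ⟨j', w, x, he, -⟩ | ⟨j', l', he⟩ | hlt⟩
    · exact h
    · exact absurd (newAtom_inj.1 he).1 h1
    · exact absurd (newAtom_inj.1 he).1 h6
    · exact absurd hlt (Nat.not_lt.2 (le_newAtom_name _ _ _ _))
  have k0 := fun j l => key 0 j l (by decide) (by decide)
  have k2 := fun j l => key 2 j l (by decide) (by decide)
  have k3 := fun j l => key 3 j l (by decide) (by decide)
  have k4 := fun j l => key 4 j l (by decide) (by decide)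
  have k5 := fun j l => key 5 j l (by decide) (by decide)
  constructor
  · intro a ha hp
    rcases hnew a ha with h' | ⟨h', -⟩
    · exact h.input a h' hp
    · exact absurd hp h'
  · simpa only [k5, k3] using h.empty
  · simpa only [k3] using h.inj
  · simpa only [k3] using h.units
  · simpa only [k2, k3] using h.ins
  · simpa only [k2, k3] using h.subs
  · simpa only [k2, k3, k4] using h.done
  · simpa only [k3, k5] using h.of_nil
  · simpa only [k2, k3] using h.of_cons
  · simpa only [k0, k3] using h.layer_zero
  · intro j l hl
    simp only [k3, k4]
    rcases hnew _ hl with h' | ⟨-, ⟨j', w, x, he, hd⟩ | ⟨j', l', he⟩ | hlt⟩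
    · exact h.layer_one j l h'
    · obtain ⟨-, -, rfl⟩ := newAtom_inj.1 he
      exact ⟨w, x, rfl, (h.done w hd).1, Or.inl hd⟩
    · exact absurd (newAtom_inj.1 he).1 (by decide)
    · exact absurd hlt (Nat.not_lt.2 (le_newAtom_name _ _ _ _))
  · intro ρ hρ i hi σ w hw
    rw [k2] at hw
    obtain ⟨h0, h1⟩ := h.disj ρ hρ i hi σ w hw
    exact ⟨h0.mono (view_mono hsub), h1.mono (view_mono hsub)⟩

/-- The rule applies only if there is no root. By `of_nil` no world then has the empty list, so the
new world can take it without violating `inj`. -/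
theorem root_step (hK : ∀ p ∈ P, p.name < K) (h : WorldInv P K S₁ D E L)
    (hs : (rootRule K).Step σ E E') :
    (∃ L', WorldInv P K S₁ D E' L') ∧ ConservativeStep P K D E E' := by
  obtain ⟨w, hw, he⟩ := rootRule_step hs
  have hsub := hs.subset
  have hno := hs.1.2
  rw [rootRule_headHolds] at hno
  push Not at hno
  have hmem : ∀ a, a ∈ E' ↔ a = emptyA K w ∨ a = subsA K w w ∨ a ∈ E := by
    intro a; rw [he]; rfl
  have k : ∀ i j l, newAtom K i j l ∈ E' ↔ (i = 5 ∧ j = 0 ∧ l = [w]) ∨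
    (i = 3 ∧ j = 0 ∧ l = [w, w]) ∨ newAtom K i j l ∈ E := by
    intro i j l; rw [hmem]; simp
  have fr : ∀ {i j l}, newAtom K i j l ∈ E → w ∉ l := fun h => newAtom_fresh hw h
  have frW : ∀ {v}, subsA K v v ∈ E → v ≠ w := by
    rintro v hv rfl
    exact fr hv (by simp)
  have hLw : Function.update L w [] w = [] := Function.update_self ..
  have hL : ∀ {v}, v ≠ w → Function.update L w [] v = L v := fun hv => Function.update_of_ne hv ..
  have hnn : ∀ v, subsA K v v ∈ E → L v ≠ [] := fun v hv hl => hno v (h.of_nil v hv hl) hv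
  refine ⟨⟨Function.update L w [], ?_, ?_, ?_, ?_, ?_, ?_, ?_, ?_, ?_, ?_, ?_, ?_⟩, ?_, ?_⟩
  · intro a ha hp
    rcases (hmem a).1 ha with rfl | rfl | ha
    · exact absurd hp (newAtom_pred_notMem hK _ _ _)
    · exact absurd hp (newAtom_pred_notMem hK _ _ _)
    · exact h.input a ha hp
  · intro v hv
    simp [k] at hv ⊢
    rcases hv with rfl | hv
    · exact ⟨Or.inl rfl, hLw⟩
    · obtain ⟨h1, h2⟩ := h.empty v hv
      exact ⟨Or.inr h1, by rw [hL (frW h1), h2]⟩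
  · intro v v' hv hv' hl
    simp [k] at hv hv'
    rcases hv with rfl | hv <;> rcases hv' with rfl | hv'
    · rfl
    · rw [hLw, hL (frW hv')] at hl
      exact absurd hl.symm (hnn _ hv')
    · rw [hLw, hL (frW hv)] at hl
      exact absurd hl (hnn _ hv)
    · rw [hL (frW hv), hL (frW hv')] at hl
      exact h.inj v v' hv hv' hl
  · intro v hv
    simp [k] at hv
    rcases hv with rfl | hv
    · simp
    · rw [hL (frW hv)]
      exact h.units v hv
  · intro c v v' x hv
    simp [k] at hv ⊢
    obtain ⟨h1, h2, h3⟩ := h.ins c v v' x hv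
    rw [hL (frW h1), hL (frW h2)]
    exact ⟨Or.inr h1, Or.inr h2, h3⟩
  · intro v v' hv
    simp [k] at hv ⊢
    rcases hv with ⟨rfl, rfl⟩ | hv
    · simp
    · obtain ⟨h1, h2, h3⟩ := h.subs v v' hv
      rw [hL (frW h1), hL (frW h2)]
      simp [h1, h2]
      simpa using h3
  · intro v hv
    simp [k] at hv ⊢
    obtain ⟨h1, h2⟩ := h.done v hv
    rw [hL (frW h1)]
    simp [h1]
    simpa using h2
  · intro v hv hl
    simp [k] at hv ⊢
    rcases hv with rfl | hv
    · exact Or.inl rfl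
    · rw [hL (frW hv)] at hl
      exact Or.inr (h.of_nil v hv hl)
  · intro v c x l hv hl
    simp [k] at hv
    rcases hv with rfl | hv
    · simp at hl
    · rw [hL (frW hv)] at hl
      obtain ⟨v', h1, h2, h3⟩ := h.of_cons v c x l hv hl
      exact ⟨v', hsub h1, by rw [hL (frW h1), h2], hsub h3⟩
  · intro j l hl
    simp [k] at hl ⊢
    obtain ⟨v, x, h1, h2, h3⟩ := h.layer_zero j l hl
    exact ⟨v, x, h1, Or.inr h2, h3⟩
  · intro j l hl
    simp [k] at hl ⊢
    obtain ⟨v, x, h1, h2, h3⟩ := h.layer_one j l hl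
    exact ⟨v, x, h1, Or.inr h2, h3⟩
  · intro ρ hρ i hi σ v hv
    simp [k] at hv
    obtain ⟨h0, h1⟩ := h.disj ρ hρ i hi σ v hv
    exact ⟨h0.mono (view_mono hsub), h1.mono (view_mono hsub)⟩
  · intro a ha hn t ht
    rcases (hmem a).1 ha with rfl | rfl | ha
    · simp at ht; subst ht; simp [k]
    · simp at ht; subst ht; simp [k]
    · exact absurd ha hn
  · intro v _
    refine view_subset_of_new (fun a ha => ?_) v
    rcases (hmem a).1 ha with rfl | rfl | ha
    · exact Or.inr ⟨newAtom_pred_notMem hK _ _ _, by simp⟩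
    · exact Or.inr ⟨newAtom_pred_notMem hK _ _ _, by simp⟩
    · exact Or.inl ha

/-- Bodies are matched against input facts and layer 0, neither of which contains nulls created by
the chase; hence there are only finitely many disjunct instances. -/
theorem map_bodyVars_mem (h : WorldInv P K S₁ D E L) {ρ : Rule} {w : Null}
    (hb : Holds σ ρ.body (view P K 0 w E)) : ∀ t ∈ ρ.bodyVars.map σ, t ∈ nullsOf D := by
  intro t ht
  obtain ⟨x, hx, rfl⟩ := List.mem_map.1 ht
  obtain ⟨a, ha, hxa⟩ := mem_varsOf.1 (Rule.mem_bodyVars.1 hx)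
  have hm := hb a ha
  have hxm : σ x ∈ (a.map σ).toList := by simpa using ⟨x, hxa, rfl⟩
  rw [mem_view] at hm
  by_cases hp : a.pred ∈ P
  · rw [Atom.inWorld_of_mem (by simpa using hp)] at hm
    exact mem_nullsOf.2 ⟨_, h.input _ hm (by simpa using hp), hxm⟩
  · rw [Atom.inWorld_of_notMem (by simpa using hp)] at hm
    obtain ⟨v, y, hl, -, hy⟩ := h.layer_zero _ _ hm
    obtain ⟨-, rfl⟩ := List.cons.inj hl
    exact hy _ hxm

/-- The new world receives the list of its parent, extended by the new instance. Inapplicability of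
the rule in the remaining cases yields both distinct lists and lists without repetition. -/
theorem branch_step (hK : ∀ p ∈ P, p.name < K) (h : WorldInv P K S₁ D E L) {ρ : Rule}
    (hρ : ρ ∈ S₁) {i : ℕ} (hi : i < ρ.head.length) (hs : (branchRule P K ρ i).Step σ E E') :
    (∃ L', WorldInv P K S₁ D E' L') ∧ ConservativeStep P K D E E' := by
  obtain ⟨w, hw, he⟩ := branchRule_step hs
  have hsub := hs.subset
  have hno := hs.1.2
  rw [branchRule_headHolds] at hno
  push Not at hno
  obtain ⟨hd, hb⟩ := branchRule_body.1 hs.1.1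
  have hx := h.map_bodyVars_mem hb
  have hunit : (ρ.disjCode i, ρ.bodyVars.map (σ ∘ dbl)) ∈ disjUnits S₁ (nullsOf D) :=
    ⟨⟨ρ, hρ, i, hi, rfl, by simp⟩, hx⟩
  generalize hc : ρ.disjCode i = c at *
  generalize ρ.bodyVars.map (σ ∘ dbl) = x at *
  generalize σ 1 = u at *
  have hmem : ∀ a, a ∈ E' ↔ a = insA K c u w x ∨ a = subsA K w w ∨ a ∈ E := by
    intro a; rw [he]; rfl
  have k : ∀ i j l, newAtom K i j l ∈ E' ↔ (i = 2 ∧ j = c ∧ l = u :: w :: x) ∨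
    (i = 3 ∧ j = 0 ∧ l = [w, w]) ∨ newAtom K i j l ∈ E := by
    intro i j l; rw [hmem]; simp
  have fr : ∀ {i j l}, newAtom K i j l ∈ E → w ∉ l := fun h => newAtom_fresh hw h
  have frW : ∀ {v}, subsA K v v ∈ E → v ≠ w := by
    rintro v hv rfl
    exact fr hv (by simp)
  obtain ⟨huW, hud⟩ := h.done u hd
  set L' := Function.update L w ((c, x) :: L u)
  have hLw : L' w = (c, x) :: L u := Function.update_self ..
  have hL : ∀ {v}, v ≠ w → L' v = L v := fun hv => Function.update_of_ne hv ..
  -- A world with this list would have a parent with list `L u`, which is `u` by `inj`; so it would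
  -- already be a successor of `u` that blocks the rule.
  have hnew : ∀ v, subsA K v v ∈ E → L v ≠ (c, x) :: L u := by
    intro v hv hl
    obtain ⟨v', h1, h2, h3⟩ := h.of_cons v c x _ hv hl
    rw [h.inj v' u h1 huW h2] at h3
    exact hno v h3 hv
  refine ⟨⟨L', ?_, ?_, ?_, ?_, ?_, ?_, ?_, ?_, ?_, ?_, ?_, ?_⟩, ?_, ?_⟩
  · intro a ha hp
    rcases (hmem a).1 ha with rfl | rfl | ha
    · exact absurd hp (newAtom_pred_notMem hK _ _ _)
    · exact absurd hp (newAtom_pred_notMem hK _ _ _)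
    · exact h.input a ha hp
  · intro v hv
    simp [k] at hv ⊢
    obtain ⟨h1, h2⟩ := h.empty v hv
    exact ⟨Or.inr h1, by rw [hL (frW h1), h2]⟩
  · intro v v' hv hv' hl
    simp [k] at hv hv'
    rcases hv with rfl | hv <;> rcases hv' with rfl | hv'
    · rfl
    · rw [hLw, hL (frW hv')] at hl
      exact absurd hl.symm (hnew _ hv')
    · rw [hLw, hL (frW hv)] at hl
      exact absurd hl (hnew _ hv)
    · rw [hL (frW hv), hL (frW hv')] at hl
      exact h.inj v v' hv hv' hl
  · intro v hv
    simp [k] at hv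
    rcases hv with rfl | hv
    · rw [hLw]
      obtain ⟨h1, h2⟩ := h.units u huW
      -- A complete world records each of its instances as an insertion into itself, so an old
      -- instance would have `u` as its own successor.
      refine ⟨List.nodup_cons.2 ⟨fun hcx => hno u (hud _ hcx) huW, h1⟩, fun y hy => ?_⟩
      rcases List.mem_cons.1 hy with rfl | hy
      · exact hunit
      · exact h2 y hy
    · rw [hL (frW hv)]
      exact h.units v hv
  · intro c' v v' y hv
    simp [k] at hv ⊢
    rcases hv with ⟨rfl, rfl, rfl, rfl⟩ | hv
    · rw [hLw, hL (frW huW)]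
      exact ⟨Or.inr huW, Or.inl rfl, Or.inl rfl⟩
    · obtain ⟨h1, h2, h3⟩ := h.ins c' v v' y hv
      rw [hL (frW h1), hL (frW h2)]
      exact ⟨Or.inr h1, Or.inr h2, h3⟩
  · intro v v' hv
    simp [k] at hv
    rcases hv with ⟨rfl, rfl⟩ | hv
    · exact ⟨by simp [k], by simp [k], [], by simp⟩
    · obtain ⟨h1, h2, l, h3, h4⟩ := h.subs v v' hv
      rw [hL (frW h1), hL (frW h2)]
      exact ⟨hsub h1, hsub h2, l, h3, fun y hy => hsub (h4 y hy)⟩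
  · intro v hv
    simp [k] at hv
    obtain ⟨h1, h2⟩ := h.done v hv
    rw [hL (frW h1)]
    exact ⟨hsub h1, fun y hy => hsub (h2 y hy)⟩
  · intro v hv hl
    simp [k] at hv ⊢
    rcases hv with rfl | hv
    · simp [hLw] at hl
    · rw [hL (frW hv)] at hl
      exact h.of_nil v hv hl
  · intro v c' y l hv hl
    simp [k] at hv
    rcases hv with rfl | hv
    · rw [hLw] at hl
      simp only [List.cons.injEq, Prod.mk.injEq] at hl
      obtain ⟨⟨rfl, rfl⟩, rfl⟩ := hl
      exact ⟨u, hsub huW, hL (frW huW), by simp [k]⟩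
    · rw [hL (frW hv)] at hl
      obtain ⟨v', h1, h2, h3⟩ := h.of_cons v c' y l hv hl
      exact ⟨v', hsub h1, by rw [hL (frW h1), h2], hsub h3⟩
  · intro j l hl
    simp [k] at hl ⊢
    obtain ⟨v, x, h1, h2, h3⟩ := h.layer_zero j l hl
    exact ⟨v, x, h1, Or.inr h2, h3⟩
  · intro j l hl
    simp [k] at hl ⊢
    obtain ⟨v, x, h1, h2, h3⟩ := h.layer_one j l hl
    exact ⟨v, x, h1, Or.inr h2, h3⟩
  · intro ρ hρ i hi σ v hv
    simp [k] at hv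
    rcases hv with ⟨-, rfl, rfl, -⟩ | hv
    · exact absurd rfl (frW huW)
    obtain ⟨h0, h1⟩ := h.disj ρ hρ i hi σ v hv
    exact ⟨h0.mono (view_mono hsub), h1.mono (view_mono hsub)⟩
  · intro a ha hn t ht
    rcases (hmem a).1 ha with rfl | rfl | ha
    · simp at ht
      rcases ht with rfl | rfl | ht
      · exact Or.inl (hsub huW)
      · simp [k]
      · exact Or.inr (hx t ht)
    · simp at ht; subst ht; simp [k]
    · exact absurd ha hn
  · intro v _
    refine view_subset_of_new (fun a ha => ?_) v
    rcases (hmem a).1 ha with rfl | rfl | ha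
    · exact Or.inr ⟨newAtom_pred_notMem hK _ _ _, by simp⟩
    · exact Or.inr ⟨newAtom_pred_notMem hK _ _ _, by simp⟩
    · exact Or.inl ha

/-- The root has the empty list, so the part of `L w` inherited on the way to the root is all of `L
w`. -/
theorem done_step (hK : ∀ p ∈ P, p.name < K) (h : WorldInv P K S₁ D E L)
    (hs : (doneRule K).Step σ E E') :
    (∃ L', WorldInv P K S₁ D E' L') ∧ ConservativeStep P K D E E' := by
  have he := doneRule_step hs
  have hsub := hs.subset
  obtain ⟨hem, hsu⟩ := doneRule_body.1 hs.1.1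
  generalize σ 1 = u at *
  generalize σ 3 = w at *
  obtain ⟨-, hLu⟩ := h.empty u hem
  obtain ⟨-, hwW, l, hLw, hl⟩ := h.subs u w hsu
  rw [hLu, List.append_nil] at hLw
  subst hLw
  have hmem : ∀ a, a ∈ E' ↔ a = doneA K w ∨ a ∈ E := by
    intro a; rw [he]; rfl
  have k : ∀ i j l, newAtom K i j l ∈ E' ↔ (i = 4 ∧ j = 0 ∧ l = [w]) ∨ newAtom K i j l ∈ E := by
    intro i j l; rw [hmem]; simp
  refine ⟨⟨L, ?_, ?_, ?_, ?_, ?_, ?_, ?_, ?_, ?_, ?_, ?_, ?_⟩, ?_, ?_⟩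
  · intro a ha hp
    rcases (hmem a).1 ha with rfl | ha
    · exact absurd hp (newAtom_pred_notMem hK _ _ _)
    · exact h.input a ha hp
  · simpa [k] using h.empty
  · simpa [k] using h.inj
  · simpa [k] using h.units
  · simpa [k] using h.ins
  · simpa [k] using h.subs
  · intro v hv
    simp [k] at hv
    rcases hv with rfl | hv
    · exact ⟨hsub hwW, fun u hu => hsub (hl u hu)⟩
    · obtain ⟨h1, h2⟩ := h.done v hv
      exact ⟨hsub h1, fun u hu => hsub (h2 u hu)⟩
  · simpa [k] using h.of_nil
  · simpa [k] using h.of_cons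
  · simpa [k] using h.layer_zero
  · intro j l hl
    simp only [k] at hl
    obtain ⟨v, x, h1, h2, h3⟩ := h.layer_one j l (by simpa using hl)
    exact ⟨v, x, h1, hsub h2, h3.imp_left fun h => hsub h⟩
  · intro ρ hρ i hi σ v hv
    simp [k] at hv
    obtain ⟨h0, h1⟩ := h.disj ρ hρ i hi σ v hv
    exact ⟨h0.mono (view_mono hsub), h1.mono (view_mono hsub)⟩
  · intro a ha hn t ht
    rcases (hmem a).1 ha with rfl | ha
    · simp at ht; subst ht; exact Or.inl (hsub hwW)
    · exact absurd ha hn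
  · intro v _
    refine view_subset_of_new (fun a ha => ?_) v
    rcases (hmem a).1 ha with rfl | ha
    · exact Or.inr ⟨newAtom_pred_notMem hK _ _ _, by simp⟩
    · exact Or.inl ha

theorem accept_step (hK : ∀ p ∈ P, p.name < K) (h : WorldInv P K S₁ D E L) {w : Null}
    (hw : subsA K w w ∈ E) (he : E' = insert (accA K w) E) :
    (∃ L', WorldInv P K S₁ D E' L') ∧ ConservativeStep P K D E E' := by
  subst he
  refine ⟨⟨L, h.of_irrelevant (Set.subset_insert _ _) ?_⟩, ?_, fun v _ =>
    view_subset_of_new ?_ v⟩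
  · rintro a (rfl | ha)
    · exact Or.inr ⟨newAtom_pred_notMem hK _ _ _, Or.inr (Or.inl ⟨_, _, rfl⟩)⟩
    · exact Or.inl ha
  · rintro a (rfl | ha) hn t ht
    · simp at ht; subst ht; exact Or.inl (Or.inr hw)
    · exact absurd ha hn
  · rintro a (rfl | ha)
    · exact Or.inr ⟨newAtom_pred_notMem hK _ _ _, by simp⟩
    · exact Or.inl ha

theorem final_step (h : WorldInv P K S₁ D E L) {goal : Predicate}
    (hgoal : goal.arity = 0) (hgK : goal.name < K) (hgP : goal ∉ P)
    (hs : (finalRule K goal).Step σ E E') :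
    (∃ L', WorldInv P K S₁ D E' L') ∧ ConservativeStep P K D E E' := by
  obtain rfl := finalRule_step hs
  have hgP' : (mkAtom goal.name ([] : List Null)).pred ∉ P := by
    obtain ⟨m, k⟩ := goal
    simp only at hgoal
    subst hgoal
    exact hgP
  refine ⟨⟨L, h.of_irrelevant (Set.subset_insert _ _) ?_⟩, ?_, fun v _ =>
    view_subset_of_new ?_ v⟩
  · rintro a (rfl | ha)
    · exact Or.inr ⟨hgP', Or.inr (Or.inr hgK)⟩
    · exact Or.inl ha
  · rintro a (rfl | ha) hn t ht
    · simp at ht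
    · exact absurd ha hn
  · rintro a (rfl | ha)
    · refine Or.inr ⟨hgP', fun j l he => ?_⟩
      have := le_newAtom_name K 1 j l
      rw [← he, mkAtom_name] at this
      omega
    · exact Or.inl ha

/-- The step creates no world and follows the ancestors of a world at most one generation further.
In a complete world all instances have been inherited, so by `disj` its layer 1 gains nothing. -/
theorem inherit_step (hK : ∀ p ∈ P, p.name < K) (hP : ∀ p ∈ P, p ∉ headPredicates S₁)
    (h : WorldInv P K S₁ D E L) {ρ : Rule} (hρ : ρ ∈ S₁) (hdl : ρ.IsDisjunctiveDatalog) {i : ℕ}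
    (hi : i < ρ.head.length) (hs : (inheritRule P K ρ i).Step σ E E') :
    (∃ L', WorldInv P K S₁ D E' L') ∧ ConservativeStep P K D E E' := by
  have hmem := inheritRule_step hdl hi hs
  have hsub := hs.subset
  obtain ⟨hin, hsu⟩ := inheritRule_body.1 hs.1.1
  have hhd := (inheritRule_headHolds hdl hi).1 hs.headHolds
  obtain ⟨hin', hsu', hh0, hh1⟩ := hhd
  have hb : ∀ b ∈ ρ.disj i, b.pred ∈ headPredicates S₁ := by
    rw [Rule.disj_eq hi]
    exact fun b hb => ⟨ρ, hρ, _, List.getElem_mem hi, b, hb, rfl⟩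
  have hbP : ∀ b ∈ ρ.disj i, b.pred ∉ P := fun b hb' hp => hP _ hp (hb b hb')
  have hbW : ∀ b ∈ ρ.disj i, ∀ l, (b.map (σ ∘ dbl)).inWorld P K l (σ 5) =
      newAtom K l b.pred.name (σ 5 :: (b.map (σ ∘ dbl)).toList) :=
    fun b hb' l => Atom.inWorld_of_notMem (by simpa using hbP b hb')
  obtain ⟨h0W, h1W, hL1⟩ := h.ins _ _ _ _ hin
  obtain ⟨-, h2W, l₁, hL2, hl₁⟩ := h.subs _ _ hsu
  have hcx : (ρ.disjCode i, ρ.bodyVars.map (σ ∘ dbl)) ∈ L (σ 5) := by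
    rw [hL2]
    rcases hL1 with hL1 | ⟨-, hL1⟩
    · simp [hL1]
    · simp [hL1]
  have hx : ∀ t ∈ ρ.bodyVars.map (σ ∘ dbl), t ∈ nullsOf D := ((h.units _ h2W).2 _ hcx).2
  have hbN : ∀ b ∈ ρ.disj i, ∀ t ∈ (b.map (σ ∘ dbl)).toList, t ∈ nullsOf D := by
    intro b hb' t ht
    obtain ⟨y, hy, rfl⟩ := by simpa using ht
    exact hx _ (by simpa using ⟨y, Rule.mem_bodyVars.2
      (Rule.disj_vars hdl hi (mem_varsOf.2 ⟨b, hb', hy⟩)), rfl⟩)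
  have hcase : ∀ a ∈ E', a ∈ E ∨
      a = insA K (ρ.disjCode i) (σ 5) (σ 5) (ρ.bodyVars.map (σ ∘ dbl)) ∨
      a = subsA K (σ 1) (σ 5) ∨ ∃ b ∈ ρ.disj i, ∃ l, (l = 0 ∨ l = 1) ∧
        a = newAtom K l b.pred.name (σ 5 :: (b.map (σ ∘ dbl)).toList) := by
    intro a ha
    rcases (hmem a).1 ha with ha | ha | ha | ⟨b, hb', ha | ha⟩
    · exact Or.inl ha
    · exact Or.inr (Or.inl ha)
    · exact Or.inr (Or.inr (Or.inl ha))
    · exact Or.inr (Or.inr (Or.inr ⟨b, hb', 0, Or.inl rfl, by rw [ha, hbW b hb']⟩))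
    · exact Or.inr (Or.inr (Or.inr ⟨b, hb', 1, Or.inr rfl, by rw [ha, hbW b hb']⟩))
  have kge : ∀ n j l, 2 ≤ n → newAtom K n j l ∈ E' → newAtom K n j l ∈ E ∨
      (n = 2 ∧ j = ρ.disjCode i ∧ l = σ 5 :: σ 5 :: ρ.bodyVars.map (σ ∘ dbl)) ∨
      (n = 3 ∧ j = 0 ∧ l = [σ 1, σ 5]) := by
    intro n j l hn ha
    rcases hcase _ ha with ha | ha | ha | ⟨b, hb', m, hm, ha⟩
    · exact Or.inl ha
    · exact Or.inr (Or.inl (newAtom_inj.1 ha))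
    · exact Or.inr (Or.inr (newAtom_inj.1 ha))
    · have := (newAtom_inj.1 ha).1
      omega
  have k4 : ∀ j l, newAtom K 4 j l ∈ E' → newAtom K 4 j l ∈ E := fun j l ha => by
    simpa using kge 4 j l (by decide) ha
  have k5 : ∀ j l, newAtom K 5 j l ∈ E' → newAtom K 5 j l ∈ E := fun j l ha => by
    simpa using kge 5 j l (by decide) ha
  have k3 : ∀ v w, subsA K v w ∈ E' → subsA K v w ∈ E ∨ (v = σ 1 ∧ w = σ 5) := fun v w ha => by
    simpa using kge 3 _ _ (by decide) ha
  have k2 : ∀ c v w x, insA K c v w x ∈ E' → insA K c v w x ∈ E ∨ (c = ρ.disjCode i ∧ v = σ 5 ∧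
      w = σ 5 ∧ x = ρ.bodyVars.map (σ ∘ dbl)) := fun c v w x ha => by
    simpa using kge 2 _ _ (by decide) ha
  have kW : ∀ v, subsA K v v ∈ E' → subsA K v v ∈ E := by
    intro v hv
    rcases k3 v v hv with hv | ⟨rfl, -⟩
    · exact hv
    · exact h0W
  refine ⟨⟨L, ?_, ?_, ?_, ?_, ?_, ?_, ?_, ?_, ?_, ?_, ?_, ?_⟩, ?_, ?_⟩
  · intro a ha hp
    rcases hcase a ha with ha | rfl | rfl | ⟨b, -, m, -, rfl⟩
    · exact h.input a ha hp
    all_goals exact absurd hp (newAtom_pred_notMem hK _ _ _)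
  · intro v hv
    obtain ⟨h1, h2⟩ := h.empty v (k5 _ _ hv)
    exact ⟨hsub h1, h2⟩
  · exact fun v w hv hw => h.inj v w (kW v hv) (kW w hw)
  · exact fun w hw => h.units w (kW w hw)
  · intro c v w x hc
    rcases k2 c v w x hc with hc | ⟨rfl, rfl, rfl, rfl⟩
    · obtain ⟨h1, h2, h3⟩ := h.ins c v w x hc
      exact ⟨hsub h1, hsub h2, h3⟩
    · exact ⟨hsub h2W, hsub h2W, Or.inr ⟨rfl, hcx⟩⟩
  · intro v w hv
    rcases k3 v w hv with hv | ⟨rfl, rfl⟩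
    · obtain ⟨h1, h2, l, h3, h4⟩ := h.subs v w hv
      exact ⟨hsub h1, hsub h2, l, h3, fun u hu => hsub (h4 u hu)⟩
    · refine ⟨hsub h0W, hsub h2W, ?_⟩
      -- Either `σ 1` is the parent of `σ 3` and one more instance is inherited, or both worlds
      -- coincide and the old containment is repeated.
      rcases hL1 with hL1 | ⟨h01, -⟩
      · refine ⟨l₁ ++ [(ρ.disjCode i, ρ.bodyVars.map (σ ∘ dbl))], by simp [hL2, hL1], ?_⟩
        intro u hu
        rcases List.mem_append.1 hu with hu | hu
        · exact hsub (hl₁ u hu)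
        · rw [List.mem_singleton.1 hu]
          exact hin'
      · rw [h01]
        exact ⟨l₁, hL2, fun u hu => hsub (hl₁ u hu)⟩
  · intro w hw
    obtain ⟨h1, h2⟩ := h.done w (k4 _ _ hw)
    exact ⟨hsub h1, fun u hu => hsub (h2 u hu)⟩
  · exact fun w hw hl => hsub (h.of_nil w (kW w hw) hl)
  · intro w c x l hw hl
    obtain ⟨v, h1, h2, h3⟩ := h.of_cons w c x l (kW w hw) hl
    exact ⟨v, hsub h1, h2, hsub h3⟩
  · intro j l hl
    rcases hcase _ hl with hl | hl | hl | ⟨b, hb', m, -, hl⟩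
    · obtain ⟨w, x, h1, h2, h3⟩ := h.layer_zero j l hl
      exact ⟨w, x, h1, hsub h2, h3⟩
    · exact absurd (newAtom_inj.1 hl).1 (by decide)
    · exact absurd (newAtom_inj.1 hl).1 (by decide)
    · exact ⟨_, _, (newAtom_inj.1 hl).2.2, hsub h2W, hbN b hb'⟩
  · intro j l hl
    rcases hcase _ hl with hl | hl | hl | ⟨b, hb', m, -, hl⟩
    · obtain ⟨w, x, h1, h2, h3⟩ := h.layer_one j l hl
      exact ⟨w, x, h1, hsub h2, h3.imp_left fun h => hsub h⟩
    · exact absurd (newAtom_inj.1 hl).1 (by decide)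
    · exact absurd (newAtom_inj.1 hl).1 (by decide)
    · exact ⟨_, _, (newAtom_inj.1 hl).2.2, hsub h2W,
        Or.inr ⟨b.map (σ ∘ dbl), hb b hb', (newAtom_inj.1 hl).2.1, rfl⟩⟩
  · intro τ hτ j hj υ w hw
    rcases k2 _ _ _ _ hw with hw | ⟨hc, rfl, -, hx'⟩
    · obtain ⟨h0, h1⟩ := h.disj τ hτ j hj υ w hw
      exact ⟨h0.mono (view_mono hsub), h1.mono (view_mono hsub)⟩
    · obtain ⟨rfl, rfl⟩ := Rule.disjCode_inj hc
      have heq := (Rule.eqOn_of_map_bodyVars hx').mono (Rule.disj_vars hdl hi)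
      exact ⟨hh0.congr heq, hh1.congr heq⟩
  · intro a ha hn t ht
    rcases hcase a ha with ha | rfl | rfl | ⟨b, hb', m, -, rfl⟩
    · exact absurd ha hn
    · simp only [newAtom_toList, List.mem_cons] at ht
      rcases ht with rfl | rfl | ht
      · exact Or.inl (hsub h2W)
      · exact Or.inl (hsub h2W)
      · exact Or.inr (hx t ht)
    · simp at ht
      rcases ht with rfl | rfl
      · exact Or.inl (hsub h0W)
      · exact Or.inl (hsub h2W)
    · rw [newAtom_toList, List.mem_cons] at ht
      rcases ht with rfl | ht
      · exact Or.inl (hsub h2W)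
      · exact Or.inr (hbN b hb' t ht)
  · intro w hw a ha
    rw [mem_view] at ha ⊢
    by_cases hp : a.pred ∈ P
    · rw [Atom.inWorld_of_mem hp] at ha ⊢
      rcases hcase a ha with ha | rfl | rfl | ⟨b, -, m, -, rfl⟩
      · exact ha
      all_goals exact absurd hp (newAtom_pred_notMem hK _ _ _)
    · rw [Atom.inWorld_of_notMem hp] at ha
      rcases hcase _ ha with ha | ha | ha | ⟨b, hb', m, -, ha⟩
      · rwa [Atom.inWorld_of_notMem hp]
      · exact absurd (newAtom_inj.1 ha).1 (by decide)
      · exact absurd (newAtom_inj.1 ha).1 (by decide)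
      · obtain ⟨-, hn, hl⟩ := newAtom_inj.1 ha
        obtain ⟨hw5, hl'⟩ := List.cons.inj hl
        subst hw5
        have hab : a = b.map (σ ∘ dbl) := Atom.ext_list hn hl'
        rw [hab]
        exact (h.disj ρ hρ i hi _ _ ((h.done _ (k4 _ _ hw)).2 _ hcx)).2 b hb'

/-- Only layer 1 of a complete world grows, and `layer_one` leaves the predicates and nulls there
unconstrained. -/
theorem sim_step (hK : ∀ p ∈ P, p.name < K) {S₂ : Set Rule}
    (hP : ∀ p ∈ P, p ∉ headPredicates S₂)
    (h : WorldInv P K S₁ D E L) {ρ : Rule} (hρ : ρ ∈ S₂) (hs : (simRule P K ρ).Step σ E E') :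
    WorldInv P K S₁ D E' L := by
  obtain ⟨η, hη, τ, -, -, -, he⟩ := simRule_step hs
  refine h.of_irrelevant hs.subset fun a ha => ?_
  rw [he] at ha
  rcases ha with ha | ⟨b, hb, rfl⟩
  · exact Or.inl ha
  · have hbP : (b.map τ).pred ∉ P := fun hp => hP _ hp ⟨ρ, hρ, η, hη, b, hb, rfl⟩
    rw [Atom.inWorld_of_notMem hbP]
    exact Or.inr ⟨newAtom_pred_notMem hK _ _ _,
      Or.inl ⟨_, _, _, rfl, (simRule_body.1 hs.1.1).1⟩⟩

/-- Chase steps with `worldRules` preserve the invariant, and they are conservative unless they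
simulate a rule of `S₂`. -/
theorem step (hK : ∀ p ∈ P, p.name < K) {goal : Predicate} (hgoal : goal.arity = 0)
    (hgK : goal.name < K) (hgP : goal ∉ P) {S₂ : Set Rule}
    (h₁ : ∀ ρ ∈ S₁, ρ.IsDisjunctiveDatalog) (hP₁ : ∀ p ∈ P, p ∉ headPredicates S₁)
    (hP₂ : ∀ p ∈ P, p ∉ headPredicates S₂)
    (h : WorldInv P K S₁ D E L) {ρ : Rule} (hρ : ρ ∈ worldRules P K goal S₁ S₂)
    (hs : ρ.Step σ E E') : (∃ L', WorldInv P K S₁ D E' L') ∧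
      ((∃ τ ∈ S₂, ρ = simRule P K τ) ∨ ConservativeStep P K D E E') := by
  rcases mem_worldRules.1 hρ with rfl | rfl | rfl | rfl | ⟨τ, hτ, rfl⟩ | ⟨τ, hτ, i, hi, rfl⟩ |
    ⟨τ, hτ, i, hi, rfl⟩ | ⟨τ, hτ, rfl⟩
  · exact (h.root_step hK hs).imp_right Or.inr
  · exact (h.done_step hK hs).imp_right Or.inr
  · obtain ⟨w, x, hl, hw, -⟩ := h.layer_one _ _ (goalRule_body.1 hs.1.1)
    obtain ⟨h1, -⟩ := List.cons.inj hl
    exact (h.accept_step hK (h1 ▸ hw) (goalRule_step hs)).imp_right Or.inr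
  · exact (h.final_step hgoal hgK hgP hs).imp_right Or.inr
  · exact (h.accept_step hK (h.done _ (acceptRule_body.1 hs.1.1).1).1
      (acceptRule_step hs)).imp_right Or.inr
  · exact (h.branch_step hK hτ hi hs).imp_right Or.inr
  · exact (h.inherit_step hK hP₁ hτ (h₁ τ hτ) hi hs).imp_right Or.inr
  · exact ⟨⟨L, h.sim_step hK hP₂ hτ hs⟩, Or.inl ⟨τ, hτ, rfl⟩⟩

end WorldInv

end

/-! ### Termination -/

theorem Rule.Step.pred_mem {ρ : Rule} {σ : Var → Null} {E E' : Interpretation}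
    (h : ρ.Step σ E E') {S : Set Rule} (hρ : ρ ∈ S) {a : Atom Null} (ha : a ∈ E') (hn : a ∉ E) :
    a.pred ∈ headPredicates S := by
  obtain ⟨-, η, hη, τ, -, rfl⟩ := h
  rcases ha with ha | ⟨b, hb, rfl⟩
  · exact absurd ha hn
  · exact ⟨ρ, hρ, η, hη, b, hb, rfl⟩

theorem nodup_lists_finite {α : Type} {U : Set α} (hU : U.Finite) :
    {l : List α | l.Nodup ∧ ∀ u ∈ l, u ∈ U}.Finite := by
  classical
  refine ((Set.finite_Iic hU.toFinset.card).biUnion fun n _ => finite_lists hU n).subset ?_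
  rintro l ⟨hn, hl⟩
  simp only [Set.mem_iUnion]
  refine ⟨l.length, ?_, rfl, hl⟩
  rw [Set.mem_Iic, ← List.toFinset_card_of_nodup hn]
  exact Finset.card_le_card fun u hu => by simpa using hl u (by simpa using hu)

theorem nullsOf_view (P : Set Predicate) (K l : ℕ) (w : Null) (E : Interpretation) :
    nullsOf (view P K l w E) ⊆ nullsOf E := by
  intro n hn
  obtain ⟨a, ha, hna⟩ := mem_nullsOf.1 hn
  refine mem_nullsOf.2 ⟨_, ha, ?_⟩
  by_cases hp : a.pred ∈ P
  · rwa [Atom.inWorld_of_mem hp]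
  · rw [Atom.inWorld_of_notMem hp]
    simp [hna]

/-- Restriction of an interpretation to a set of predicates. -/
def restrictTo (R : Set Predicate) (I : Interpretation) : Interpretation := {a ∈ I | a.pred ∈ R}

section

variable {R P : Set Predicate} {I E E' : Interpretation} {σ : Var → Null} {K : ℕ}

theorem restrictTo_subset : restrictTo R I ⊆ I := fun _ h => h.1

theorem holds_restrictTo {c : List (Atom Var)} (hc : ∀ a ∈ c, a.pred ∈ R) :
    Holds σ c (restrictTo R I) ↔ Holds σ c I :=
  ⟨fun h => h.mono restrictTo_subset, fun h a ha => ⟨h a ha, hc a ha⟩⟩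

theorem headHolds_restrictTo {ρ : Rule} (hρ : ∀ η ∈ ρ.head, ∀ a ∈ η, a.pred ∈ R) :
    ρ.HeadHolds σ (restrictTo R I) ↔ ρ.HeadHolds σ I := by
  refine ⟨fun h => h.mono restrictTo_subset, ?_⟩
  rintro ⟨η, hη, σ', he, hh⟩
  exact ⟨η, hη, σ', he, (holds_restrictTo (hρ η hη)).2 hh⟩

theorem applicable_restrictTo {ρ : Rule} (hb : ∀ a ∈ ρ.body, a.pred ∈ R)
    (hρ : ∀ η ∈ ρ.head, ∀ a ∈ η, a.pred ∈ R) :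
    ρ.Applicable σ (restrictTo R I) ↔ ρ.Applicable σ I := by
  rw [Rule.Applicable, Rule.Applicable, holds_restrictTo hb, headHolds_restrictTo hρ]

/-- Simulating a rule in another world does not affect world `w`. -/
theorem view_simRule_of_ne {ρ : Rule} (hP : ∀ η ∈ ρ.head, ∀ a ∈ η, a.pred ∉ P)
    (hK : ∀ p ∈ P, p.name < K) {w : Null} (hw : σ 1 ≠ w)
    (h : (simRule P K ρ).Step σ E E') : view P K 1 w E' ⊆ view P K 1 w E := by
  obtain ⟨η, hη, τ, -, -, -, he⟩ := simRule_step h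
  intro a ha
  rw [mem_view] at ha ⊢
  rw [he] at ha
  rcases ha with ha | ⟨b, hb, heq⟩
  · exact ha
  · rw [Atom.inWorld_of_notMem (a := b.map τ) (hP η hη b hb)] at heq
    by_cases hp : a.pred ∈ P
    · rw [Atom.inWorld_of_mem hp] at heq
      rw [heq] at hp
      exact absurd hp (newAtom_pred_notMem hK _ _ _)
    · rw [Atom.inWorld_of_notMem hp] at heq
      exact absurd (List.cons.inj (newAtom_inj.1 heq).2.2).1.symm hw

/-- Simulating a rule in world `w` is a chase step on the contents of this world. -/
theorem step_view_of_simRule {ρ : Rule} (hb : ∀ a ∈ ρ.body, a.pred ∈ R)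
    (hR : ∀ η ∈ ρ.head, ∀ a ∈ η, a.pred ∈ R) (hP : ∀ η ∈ ρ.head, ∀ a ∈ η, a.pred ∉ P)
    (hK : ∀ p ∈ P, p.name < K) (h : (simRule P K ρ).Step σ E E') :
    ρ.Step (σ ∘ dbl) (restrictTo R (view P K 1 (σ 1) E))
      (restrictTo R (view P K 1 (σ 1) E')) := by
  obtain ⟨η, hη, τ, h1, h2, h3, he⟩ := simRule_step h
  refine ⟨(applicable_restrictTo hb hR).2 ⟨(simRule_body.1 h.1.1).2,
    fun hh => h.1.2 (simRule_headHolds.2 hh)⟩, η, hη, τ, ⟨h1, h2, fun y hy hn => h3 y hy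
    (nullsOf_view P K 1 (σ 1) E (nullsOf_mono restrictTo_subset hn))⟩, ?_⟩
  ext a
  constructor
  · rintro ⟨ha, haR⟩
    rw [mem_view, he] at ha
    rcases ha with ha | ⟨b, hb, heq⟩
    · exact Or.inl ⟨ha, haR⟩
    · right
      rw [Atom.inWorld_of_notMem (a := b.map τ) (hP η hη b hb)] at heq
      by_cases hp : a.pred ∈ P
      · rw [Atom.inWorld_of_mem hp] at heq
        rw [heq] at hp
        exact absurd hp (newAtom_pred_notMem hK _ _ _)
      · rw [Atom.inWorld_of_notMem hp] at heq
        obtain ⟨-, hn, hl⟩ := newAtom_inj.1 heq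
        exact ⟨b, hb, Atom.ext_list hn (List.cons.inj hl).2⟩
  · rintro (ha | ⟨b, hb, rfl⟩)
    · exact ⟨view_mono h.subset ha.1, ha.2⟩
    · refine ⟨?_, hR η hη b hb⟩
      rw [mem_view, he]
      exact Or.inr ⟨b, hb, rfl⟩

end

/-- An infinite chase would have infinitely many steps of one of two kinds: steps outside the
simulation of `S₂`, or simulated steps in one of finitely many worlds. The former only produce atoms
over finitely many nulls; the latter form a chase with `S₂` that terminates by assumption. -/
theorem worldRules_chaseTerminating {P : Set Predicate} {K : ℕ} (hK : ∀ p ∈ P, p.name < K)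
    {goal : Predicate} (hgoal : goal.arity = 0) (hgK : goal.name < K) (hgP : goal ∉ P)
    {S₁ S₂ : Set Rule} (hf₁ : S₁.Finite) (hf₂ : S₂.Finite)
    (h₁ : ∀ ρ ∈ S₁, ρ.IsDisjunctiveDatalog) (h₂ : ∀ ρ ∈ S₂, ρ.IsExistential)
    (hP₁ : ∀ p ∈ P, p ∉ headPredicates S₁) (hP₂ : ∀ p ∈ P, p ∉ headPredicates S₂)
    {D : Interpretation} (hD : D.Finite) (hPD : IsOver P D) {Q : Set Predicate}
    (hQ : ∀ p ∈ bodyPredicates S₂ ∪ headPredicates S₂, p ∈ P ∨ p ∈ headPredicates S₁ → p ∈ Q)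
    (hterm : ∀ D₂ : Interpretation, IsDatabase D₂ → IsOver Q D₂ → ChaseTerminating S₂ D₂) :
    ChaseTerminating (worldRules P K goal S₁ S₂) D := by
  intro T hT
  by_contra hinf
  obtain ⟨E, hE0, hsteps, hfair⟩ :=
    exists_step_sequence (worldRules_isExistential h₂) hT hinf
  choose ρs hρs σs hstep using hsteps
  have hinv : ∀ n, ∃ L, WorldInv P K S₁ D (E n) L := by
    intro n
    induction n with
    | zero =>
      rw [hE0]
      exact ⟨_, WorldInv.init hK hPD⟩
    | succ n ih =>
      obtain ⟨L, hL⟩ := ih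
      exact (hL.step hK hgoal hgK hgP h₁ hP₁ hP₂ (hρs n) (hstep n)).1
  have hcons : ∀ n, (∃ τ ∈ S₂, ρs n = simRule P K τ) ∨
      ConservativeStep P K D (E n) (E (n + 1)) := by
    intro n
    obtain ⟨L, hL⟩ := hinv n
    exact (hL.step hK hgoal hgK hgP h₁ hP₁ hP₂ (hρs n) (hstep n)).2
  have hmono : Monotone E := monotone_nat_of_le_succ fun n => (hstep n).subset
  have hN := nullsOf_finite hD
  -- there are finitely many worlds
  set W : Set Null := {w | ∃ n, subsA K w w ∈ E n}
  have hWfin : W.Finite := by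
    by_contra hWinf
    have hlists := nodup_lists_finite (disjUnits_finite hf₁ hN)
    obtain ⟨t, htW, htc⟩ := Set.Infinite.exists_subset_card_eq hWinf (hlists.toFinset.card + 1)
    have : ∀ w, ∃ n, w ∈ t → subsA K w w ∈ E n := by
      intro w
      by_cases hw : w ∈ t
      · obtain ⟨n, hn⟩ := htW hw
        exact ⟨n, fun _ => hn⟩
      · exact ⟨0, fun h => absurd h hw⟩
    choose f hf using this
    -- The map `L` depends on the stage, so the finitely many chosen worlds are compared at a common
    -- stage.
    have hall : ∀ w ∈ t, subsA K w w ∈ E (t.sup f) := fun w hw =>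
      hmono (Finset.le_sup hw) (hf w hw)
    obtain ⟨L, hL⟩ := hinv (t.sup f)
    have := Finset.card_le_card_of_injOn L (s := t) (t := hlists.toFinset)
      (fun w hw => by simpa using hL.units w (hall w hw))
      (fun v hv w hw h => hL.inj v w (hall v hv) (hall w hw) h)
    omega
  -- there are finitely many steps that do not simulate rules of `S₂`
  have hnonsim : {n | ¬ ∃ τ ∈ S₂, ρs n = simRule P K τ}.Finite := by
    choose f hf hfn using fun n => (hstep n).exists_new
    have hA := finite_atoms (headPredicates_finite (worldRules_finite (P := P) (K := K) goal
      hf₁ hf₂)) (hWfin.union hN)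
    refine Set.Finite.of_finite_image (f := f) (hA.subset ?_) ?_
    · rintro _ ⟨n, hn, rfl⟩
      refine ⟨(hstep n).pred_mem (hρs n) (hf n) (hfn n), fun t ht => ?_⟩
      exact (((hcons n).resolve_left hn).1 _ (hf n) (hfn n) t ht).imp_left fun h => ⟨_, h⟩
    · have hlt : ∀ m n, m < n → f m ≠ f n := fun m n hmn he =>
        hfn n (he ▸ hmono (Nat.succ_le_of_lt hmn) (hf m))
      intro m _ n _ he
      rcases lt_trichotomy m n with h | h | h
      · exact absurd he (hlt m n h)
      · exact h
      · exact absurd he.symm (hlt n m h)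
  -- there are finitely many steps that simulate rules of `S₂` in a given world
  have hsim : ∀ w, {n | (∃ τ ∈ S₂, ρs n = simRule P K τ) ∧ σs n 1 = w}.Finite := by
    intro w
    by_contra hsinf
    have hsinf : {n | (∃ τ ∈ S₂, ρs n = simRule P K τ) ∧ σs n 1 = w}.Infinite := hsinf
    have hdone : ∃ n, doneA K w ∈ E n := by
      obtain ⟨n, ⟨τ, -, hτ⟩, rfl⟩ := hsinf.nonempty
      have := (hstep n).1.1
      rw [hτ, simRule_body] at this
      exact ⟨n, this.1⟩
    classical
    -- Stage `s` is the last one at which `w` is incomplete. Layer 1 of `w` then holds no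
    -- consequences of `S₂`, and all later steps outside the simulation leave it unchanged.
    obtain ⟨s, hs⟩ : ∃ s, Nat.find hdone = s + 1 := by
      refine Nat.exists_eq_succ_of_ne_zero fun h0 => ?_
      have := Nat.find_spec hdone
      rw [h0, hE0] at this
      exact newAtom_pred_notMem hK _ _ _ (hPD _ this)
    have hds : doneA K w ∉ E s := Nat.find_min hdone (by omega)
    have hds' : doneA K w ∈ E (s + 1) := hs ▸ Nat.find_spec hdone
    have hdn : ∀ n, s + 1 ≤ n → doneA K w ∈ E n := fun n hn => hmono hn hds'
    set R := bodyPredicates S₂ ∪ headPredicates S₂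
    have hRb : ∀ ρ ∈ S₂, ∀ a ∈ ρ.body, a.pred ∈ R := fun ρ hρ a ha => Or.inl ⟨ρ, hρ, a, ha, rfl⟩
    have hRh : ∀ ρ ∈ S₂, ∀ η ∈ ρ.head, ∀ a ∈ η, a.pred ∈ R :=
      fun ρ hρ η hη a ha => Or.inr ⟨ρ, hρ, η, hη, a, ha, rfl⟩
    have hPh : ∀ ρ ∈ S₂, ∀ η ∈ ρ.head, ∀ a ∈ η, a.pred ∉ P :=
      fun ρ hρ η hη a ha hp => hP₂ _ hp ⟨ρ, hρ, η, hη, a, ha, rfl⟩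
    -- Input facts and facts from `S₁` may use predicates foreign to `S₂`; restricting to `R`
    -- removes them without affecting applicability.
    let V : ℕ → Interpretation := fun k => restrictTo R (view P K 1 w (E (s + k)))
    have hVeq : ∀ k, view P K 1 w (E (s + k + 1)) ⊆ view P K 1 w (E (s + k)) → V (k + 1) = V k := by
      intro k hk
      have : view P K 1 w (E (s + k + 1)) = view P K 1 w (E (s + k)) :=
        subset_antisymm hk (view_mono (hstep (s + k)).subset)
      exact congrArg (restrictTo R) this
    have hVstep : ∀ k τ, τ ∈ S₂ → ρs (s + k) = simRule P K τ → σs (s + k) 1 = w →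
        τ.Step (σs (s + k) ∘ dbl) (V k) (V (k + 1)) := by
      rintro k τ hτ hρ rfl
      have := hstep (s + k)
      rw [hρ] at this
      exact step_view_of_simRule (hRb τ hτ) (hRh τ hτ) (hPh τ hτ) hK this
    refine not_chaseTerminating (V := V) h₂ ?_ ?_ ?_ (hterm (V 0) ?_ ?_)
    · intro k
      by_cases hk : ∃ τ ∈ S₂, ρs (s + k) = simRule P K τ
      · obtain ⟨τ, hτ, hρ⟩ := hk
        by_cases hw : σs (s + k) 1 = w
        · exact Or.inr ⟨τ, hτ, _, hVstep k τ hτ hρ hw⟩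
        · have := hstep (s + k)
          rw [hρ] at this
          exact Or.inl (hVeq k (view_simRule_of_ne (hPh τ hτ) hK hw this))
      · exact Or.inl (hVeq k (((hcons (s + k)).resolve_left hk).2 w (hdn _ (by omega))))
    · intro τ hτ σ
      obtain ⟨m, hm⟩ := hfair (simRule P K τ) (mem_worldRules.2
        (Or.inr (Or.inr (Or.inr (Or.inr (Or.inr (Or.inr (Or.inr ⟨τ, hτ, rfl⟩))))))))
        (glue σ fun _ => w)
      -- The extra `1` ensures `1 ≤ k`, so that `w` is complete at stage `s + k`.
      refine ⟨m + 1, fun k hk happ => hm (s + k) (by omega) ?_⟩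
      obtain ⟨hb, hh⟩ := (applicable_restrictTo (hRb τ hτ) (hRh τ hτ)).1 happ
      refine ⟨simRule_body.2 ?_, fun h => hh ?_⟩
      · simpa using ⟨hdn (s + k) (by omega), hb⟩
      · simpa using simRule_headHolds.1 h
    · intro hfinV
      refine hsinf (((Set.finite_Iio s).union (hfinV.image fun k => s + k)).subset ?_)
      rintro n ⟨⟨τ, hτ, hρ⟩, hw⟩
      rcases lt_or_ge n s with hn | hn
      · exact Or.inl hn
      · obtain ⟨k, rfl⟩ := Nat.exists_eq_add_of_le hn
        refine Or.inr ⟨k, fun he => ?_, rfl⟩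
        obtain ⟨a, ha, hna⟩ := (hVstep k τ hτ hρ hw).exists_new
        exact hna (he ▸ ha)
    · have hEfin : ∀ n, (E n).Finite := by
        intro n
        induction n with
        | zero => exact hE0.symm ▸ hD
        | succ n ih => exact (hstep n).finite ih
      refine (finite_atoms ((bodyPredicates_finite hf₂).union (headPredicates_finite hf₂))
        (nullsOf_finite (hEfin s))).subset ?_
      rintro a ⟨ha, haR⟩
      exact ⟨haR, fun t ht => nullsOf_view P K 1 w (E s) (mem_nullsOf.2 ⟨a, ha, ht⟩)⟩
    · rintro a ⟨ha, haR⟩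
      refine hQ _ haR ?_
      by_cases hp : a.pred ∈ P
      · exact Or.inl hp
      · right
        have ha : a.inWorld P K 1 w ∈ E s := ha
        rw [Atom.inWorld_of_notMem hp] at ha
        obtain ⟨L, hL⟩ := hinv s
        obtain ⟨v, x, hvx, -, h⟩ := hL.layer_one _ _ ha
        -- As `w` is incomplete at stage `s`, only the alternative with a head predicate of `S₁`
        -- remains.
        obtain ⟨rfl, rfl⟩ := List.cons.inj hvx
        rcases h with h | ⟨b, hb, hn, hl⟩
        · exact absurd h hds
        · rwa [Atom.ext_list hn hl]
  refine Set.infinite_univ ((hnonsim.union (hWfin.biUnion fun w _ => hsim w)).subset ?_)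
  intro n _
  by_cases hn : ∃ τ ∈ S₂, ρs n = simRule P K τ
  · right
    simp only [Set.mem_iUnion]
    refine ⟨σs n 1, ?_, hn, rfl⟩
    obtain ⟨τ, -, hτ⟩ := hn
    have := (hstep n).1.1
    rw [hτ, simRule_body] at this
    obtain ⟨L, hL⟩ := hinv n
    exact ⟨n, (hL.done _ this.1).1⟩
  · exact Or.inl hn

/-! ### Goals that are input predicates, and the main theorem -/

theorem entails_iff_of_input {S : Set Rule} {goal : Predicate} (hgoal : goal.arity = 0)
    (hg : goal ∉ headPredicates S) {D : Interpretation} :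
    Entails S D (nullaryFact goal hgoal) ↔ Entails ∅ D (nullaryFact goal hgoal) := by
  constructor
  · intro h I _ ⟨f, hf⟩
    rw [isModelOf_nullaryFact]
    suffices hD : mkAtom goal.name [] ∈ D by
      simpa [mkAtom_map] using hf _ hD
    by_contra hD
    -- The set of all facts but the goal satisfies every rule, since no head mentions the goal. So
    -- entailment forces the goal into `D`.
    have := h {a | a ≠ mkAtom goal.name []} ?_ ⟨id, fun a ha he => hD ?_⟩
    · rw [isModelOf_nullaryFact] at this
      exact this rfl
    · intro ρ hρ σ _
      obtain ⟨η, hη⟩ := List.exists_mem_of_ne_nil _ ρ.head_ne_nil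
      refine ⟨η, hη, σ, fun _ _ => rfl, fun a ha he => hg ⟨ρ, hρ, η, hη, a, ha, ?_⟩⟩
      have : (a.map σ).pred = (mkAtom goal.name ([] : List Null)).pred := congrArg Atom.pred he
      obtain ⟨m, k⟩ := goal
      simp only at hgoal
      subst hgoal
      exact this
    · exact (show a = _ from he) ▸ ha
  · exact fun h I _ hI => h I (fun ρ hρ => absurd hρ (Set.notMem_empty ρ)) hI

theorem chaseTerminating_empty (D : Interpretation) : ChaseTerminating ∅ D := by
  intro T hT
  refine (Set.finite_singleton []).subset ?_
  rintro (_ | ⟨i, v⟩) hv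
  · rfl
  · obtain ⟨ρ, hρ, -⟩ := hT.2.1 v (T.parent_mem i v hv) ⟨i, hv⟩
    exact absurd hρ (Set.notMem_empty ρ)

end DisjRules

open DisjRules
theorem mainTheorem5 (goal : Predicate) (hgoal : goal.arity = 0)
    (S S₁ S₂ : Set Rule) (hS : S.Finite) (hsplit : IsSplit S S₁ S₂) :
    ∃ S' : Set Rule, S'.Finite ∧ (∀ ρ ∈ S', ρ.IsExistential) ∧
      ∀ D : Interpretation, IsDatabase D → IsOver (inputSchema S) D →
        (Entails S D (nullaryFact goal hgoal) ↔ Entails S' D (nullaryFact goal hgoal)) ∧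
        ((∀ D₂ : Interpretation, IsDatabase D₂ →
            IsOver (inputSchema S₂ ∪ (headPredicates S₁ ∩ headPredicates S₂)) D₂ →
              ChaseTerminating S₂ D₂) →
          ChaseTerminating S' D) := by
  obtain ⟨h₁, h₂, rfl, hsp⟩ := hsplit
  -- The simulation expects goal facts to belong to worlds, which fails for an input predicate. In
  -- that case no rule derives the goal and the empty rule set suffices.
  by_cases hgP : goal ∈ inputSchema (S₁ ∪ S₂)
  · exact ⟨∅, Set.finite_empty, fun ρ hρ => absurd hρ (Set.notMem_empty ρ), fun D _ _ =>
      ⟨entails_iff_of_input hgoal hgP.2, fun _ => chaseTerminating_empty D⟩⟩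
  set P := inputSchema (S₁ ∪ S₂)
  have hP : ∀ p ∈ P, p ∉ headPredicates (S₁ ∪ S₂) := fun p hp => hp.2
  have hsub : ∀ {A : Set Rule}, A ⊆ S₁ ∪ S₂ → headPredicates A ⊆ headPredicates (S₁ ∪ S₂) :=
    fun hA p ⟨ρ, hρ, h⟩ => ⟨ρ, hA hρ, h⟩
  have hf₁ : S₁.Finite := hS.subset Set.subset_union_left
  have hf₂ : S₂.Finite := hS.subset Set.subset_union_right
  have hP₁ : ∀ p ∈ P, p ∉ headPredicates S₁ :=
    fun p hp h => hP p hp (hsub Set.subset_union_left h)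
  have hP₂ : ∀ p ∈ P, p ∉ headPredicates S₂ :=
    fun p hp h => hP p hp (hsub Set.subset_union_right h)
  -- Names from `b + 1` on occur neither in the rules nor as the name of the goal, and are free for
  -- the new predicates.
  obtain ⟨b, hb⟩ := ((((bodyPredicates_finite hS).union (headPredicates_finite hS)).insert
    goal).image Predicate.name).bddAbove
  have hK : ∀ p ∈ P, p.name < b + 1 := fun p hp =>
    Nat.lt_succ_of_le (hb ⟨p, Or.inr hp.1, rfl⟩)
  have hgK : goal.name < b + 1 := Nat.lt_succ_of_le (hb ⟨goal, Or.inl rfl, rfl⟩)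
  refine ⟨worldRules P (b + 1) goal S₁ S₂, worldRules_finite goal hf₁ hf₂,
    worldRules_isExistential h₂, fun D hD hPD => ⟨⟨?_, ?_⟩, ?_⟩⟩
  · exact entails_worldRules hD hPD hf₁ h₁ h₂ (hsp D hD hPD) hgoal hgP
  · exact entails_of_entails_worldRules hK hgoal hgK h₁ hP hPD
  · refine worldRules_chaseTerminating hK hgoal hgK hgP hf₁ hf₂ h₁ h₂ hP₁ hP₂ hD hPD ?_
    -- A predicate of `S₂` available when a world becomes complete is an input predicate of `S₂`, or
    -- else a head predicate of both `S₁` and `S₂`.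
    rintro p hp (h | h)
    · exact Or.inl ⟨hp, hP₂ p h⟩
    · by_cases hp₂ : p ∈ headPredicates S₂
      · exact Or.inr ⟨h, hp₂⟩
      · exact Or.inl ⟨hp, hp₂⟩
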